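/- Let $F$ be a field of characteristic $p>0$, let $E/F$ be a finite-dimensional purely inseparable field extension of exponent one, and let $\delta$ be a derivation of $E$ with $\mathrm{Const}(\delta)=\{a\in E\mid\delta(a)=0\}=F$ whose minimal polynomial over $F$ is $t^p-t$. Let $D$ be a finite-dimensional associative division algebra over $F$ with centre $F$ such that $D_E=D\otimes_F E$ is a division algebra, and extend $\delta$ to $D_E$ by $\delta(b\otimes a)=b\otimes\delta(a)$, so that $\delta|_D=0$. For an associative ring $A$ with a derivation $\delta$, let $A[t;\delta]$ be the differential polynomial ring (polynomials with coefficients on the left and $ta=at+\delta(a)$). For monic $f\in A[t;\delta]$ of degree $m$, $A[t;\delta]/A[t;\delta]f$ denotes the nonassociative (that is, not necessarily associative) algebra of all polynomials of degree less than $m$ with the multiplication $g\circ h=gh \bmod_r f$, where $\bmod_r f$ is the remainder of right division by $f$ ($g=qf+r$, $\deg r<m$). For $z\in D_E$ let $V_p(z)\in D_E$ be the element with $(t-z)^p=t^p-V_p(z)$ in $D_E[t;\delta]$. A nonassociative algebra is a division algebra if it is nonzero and left and right multiplication by each nonzero element are bijective. Let $d\in E$, $f(t)=t^p-t-d$ and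 $(E,\delta,d)=E[t;\delta]/E[t;\delta]f(t)$. Then: (1) There is an isomorphism of $F$-algebras $$(E,\delta,d)\otimes_F D\;\cong\; D_E[t;\delta]/D_E[t;\delta]f(t),$$ given by $at^i\otimes b\mapsto (b\otimes a)t^i$ for $a\in E$, $b\in D$, $0\le i<p$. (2) $(E,\delta,d)\otimes_F D$ has dimension $p^2[D:F]$ over $F$, and it is a division algebra if and only if $d\neq V_p(z)-z$ for all $z\in D_E$; equivalently, if and only if $d\neq t^p-(t-z)^p-z$ for all $z\in D_E$. (3) Under the isomorphism in (1), the map $G=G_{\mathrm{id},-1}:\sum_{i<p}a_it^i\mapsto\sum_{i<p}a_i(t-1)^i$ ($a_i\in D_E$) is an $F$-algebra automorphism of $(E,\delta,d)\otimes_F D$ which is the identity on $D$ and generates a cyclic subgroup of order $p$ of $\mathrm{Aut}_F((E,\delta,d)\otimes_F D)$. -/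

import Mathlib

open scoped Polynomial
open scoped TensorProduct

noncomputable section

/-- An `F`-linear derivation of a (not necessarily commutative) `F`-algebra `A`. -/
structure NCDerivation (F A : Type*) [CommRing F] [Ring A] [Algebra F A] extends A →ₗ[F] A where
  leibniz' : ∀ a b : A, toFun (a * b) = a * toFun b + toFun a * b

/-- A derivation of a commutative algebra, viewed as an `NCDerivation`. -/
def Derivation.toNC {F E : Type*} [CommRing F] [CommRing E] [Algebra F E]
    (δ : Derivation F E E) : NCDerivation F E where
  toLinearMap := δ.toLinearMap
  leibniz' a b := by
    change δ (a * b) = a * δ b + δ a * b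
    rw [δ.leibniz, smul_eq_mul, smul_eq_mul, mul_comm b]

/-- The extension of a derivation `δ` of `E` to `D_E = D ⊗ E` which vanishes on `D`:
it sends `b ⊗ a` to `b ⊗ δ a`. -/
def Derivation.extendNC {F E : Type*} [CommRing F] [CommRing E] [Algebra F E]
    (δ : Derivation F E E) (D : Type*) [Ring D] [Algebra F D] :
    NCDerivation F (D ⊗[F] E) where
  toLinearMap := δ.toLinearMap.lTensor D
  leibniz' x y := by
    change δ.toLinearMap.lTensor D (x * y) =
      x * δ.toLinearMap.lTensor D y + δ.toLinearMap.lTensor D x * y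
    induction x with
    | zero => simp
    | add x₁ x₂ h₁ h₂ => rw [add_mul, map_add, h₁, h₂, map_add]; noncomm_ring
    | tmul a e =>
      induction y with
      | zero => simp
      | add y₁ y₂ h₁ h₂ => rw [mul_add, map_add, h₁, h₂, map_add]; noncomm_ring
      | tmul b e' =>
        simp only [Algebra.TensorProduct.tmul_mul_tmul, LinearMap.lTensor_tmul]
        rw [← TensorProduct.tmul_add]
        congr 1
        change δ (e * e') = e * δ e' + δ e * e'
        rw [δ.leibniz, smul_eq_mul, smul_eq_mul, mul_comm e']

section DiffPoly

variable {F A : Type*} [CommRing F] [Ring A] [Algebra F A]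

/-- The differential polynomial ring `A[t;δ]`. Its elements are the polynomials
`a₀ + a₁ t + ⋯ + aₙ tⁿ` with coefficients in `A` on the left, with termwise addition; the
multiplication is the one with `t a = a t + δ a`. -/
def DiffPoly (_δ : NCDerivation F A) : Type _ := A[X]

namespace DiffPoly

variable (δ : NCDerivation F A)

instance : AddCommGroup (DiffPoly δ) := inferInstanceAs (AddCommGroup A[X])
instance : Module F (DiffPoly δ) := inferInstanceAs (Module F A[X])

/-- Left multiplication by `t` : `a tⁱ ↦ a tⁱ⁺¹ + δ(a) tⁱ`. -/
def tMul : Module.End F A[X] :=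
  Polynomial.lsum fun i =>
    (Polynomial.monomial (i + 1) : A →ₗ[A] A[X]).restrictScalars F +
      ((Polynomial.monomial i : A →ₗ[A] A[X]).restrictScalars F) ∘ₗ δ.toLinearMap

/-- The multiplication `(∑ aᵢ tⁱ) g = ∑ aᵢ (tⁱ g)` of `A[t;δ]`. -/
def mulHom : A[X] →ₗ[F] Module.End F A[X] :=
  Polynomial.lsum fun i =>
    (LinearMap.mulRight F (tMul δ ^ i)) ∘ₗ (Algebra.lsmul F F A[X] : A →ₐ[F] _).toLinearMap

instance : Mul (DiffPoly δ) := ⟨fun f g => mulHom δ f g⟩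
instance : One (DiffPoly δ) := ⟨(1 : A[X])⟩

/-- The constant polynomial `a`. -/
def C (a : A) : DiffPoly δ := Polynomial.C a

/-- The indeterminate. -/
def t : DiffPoly δ := (Polynomial.X : A[X])

theorem tMul_monomial (i : ℕ) (a : A) : tMul δ (Polynomial.monomial i a) =
    Polynomial.monomial (i + 1) a + Polynomial.monomial i (δ.toLinearMap a) := by
  simp [tMul, Polynomial.lsum_apply, Polynomial.sum_monomial_index]

theorem mulHom_monomial (i : ℕ) (a : A) (g : A[X]) :
    mulHom δ (Polynomial.monomial i a) g = a • (tMul δ ^ i) g := by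
  simp [mulHom, Polynomial.lsum_apply, Polynomial.sum_monomial_index]

theorem deriv_one : δ.toLinearMap 1 = 0 := by
  have h := δ.leibniz' 1 1
  change δ.toLinearMap (1 * 1) = 1 * δ.toLinearMap 1 + δ.toLinearMap 1 * 1 at h
  simpa using h

theorem deriv_mul (a b : A) :
    δ.toLinearMap (a * b) = a * δ.toLinearMap b + δ.toLinearMap a * b := δ.leibniz' a b

theorem tMul_pow_one (i : ℕ) : (tMul δ ^ i) (1 : A[X]) = Polynomial.monomial i 1 := by
  induction i with
  | zero => simp
  | succ i ih => rw [pow_succ', Module.End.mul_apply, ih, tMul_monomial, deriv_one]; simp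

theorem tMul_smul (a : A) (g : A[X]) :
    tMul δ (a • g) = a • tMul δ g + δ.toLinearMap a • g := by
  induction g using Polynomial.induction_on' with
  | add p q hp hq => rw [smul_add, map_add, hp, hq, map_add, smul_add, smul_add]; abel
  | monomial n b =>
    rw [Polynomial.smul_monomial, tMul_monomial, tMul_monomial, smul_add,
      Polynomial.smul_monomial, Polynomial.smul_monomial, Polynomial.smul_monomial, smul_eq_mul,
      smul_eq_mul, smul_eq_mul, deriv_mul, map_add, add_assoc]

theorem mulHom_smul (a : A) (f g : A[X]) : mulHom δ (a • f) g = a • mulHom δ f g := by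
  induction f using Polynomial.induction_on' with
  | add p q hp hq => rw [smul_add, map_add, map_add, LinearMap.add_apply, hp, hq,
      LinearMap.add_apply, smul_add]
  | monomial n b =>
    rw [Polynomial.smul_monomial, mulHom_monomial, mulHom_monomial, smul_smul, smul_eq_mul]

theorem mulHom_tMul (f g : A[X]) : mulHom δ (tMul δ f) g = tMul δ (mulHom δ f g) := by
  induction f using Polynomial.induction_on' with
  | add p q hp hq => simp only [map_add, LinearMap.add_apply, hp, hq]
  | monomial n b =>
    rw [tMul_monomial, map_add, LinearMap.add_apply, mulHom_monomial, mulHom_monomial,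
      mulHom_monomial, tMul_smul, pow_succ', Module.End.mul_apply]

theorem mulHom_tMul_pow (i : ℕ) (f g : A[X]) :
    mulHom δ ((tMul δ ^ i) f) g = (tMul δ ^ i) (mulHom δ f g) := by
  induction i with
  | zero => simp
  | succ i ih => rw [pow_succ', Module.End.mul_apply, mulHom_tMul, ih, Module.End.mul_apply]

theorem mulHom_assoc (f g h : A[X]) :
    mulHom δ (mulHom δ f g) h = mulHom δ f (mulHom δ g h) := by
  induction f using Polynomial.induction_on' with
  | add p q hp hq => simp only [map_add, LinearMap.add_apply, hp, hq]
  | monomial n b => rw [mulHom_monomial, mulHom_monomial, mulHom_smul, mulHom_tMul_pow]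

theorem mulHom_one (f : A[X]) : mulHom δ f 1 = f := by
  induction f using Polynomial.induction_on' with
  | add p q hp hq => rw [map_add, LinearMap.add_apply, hp, hq]
  | monomial n b =>
    rw [mulHom_monomial, tMul_pow_one, Polynomial.smul_monomial, smul_eq_mul, mul_one]

theorem one_mulHom (f : A[X]) : mulHom δ 1 f = f := by
  rw [← Polynomial.monomial_zero_one, mulHom_monomial]
  simp

instance : Ring (DiffPoly δ) :=
  { (inferInstance : AddCommGroup (DiffPoly δ)) with
    mul := (· * ·)
    one := 1
    mul_assoc := mulHom_assoc δ
    one_mul := one_mulHom δ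
    mul_one := mulHom_one δ
    left_distrib := fun f g h => map_add (mulHom δ f) g h
    right_distrib := fun f g h => LinearMap.congr_fun (map_add (mulHom δ) f g) h
    zero_mul := fun f => LinearMap.congr_fun (map_zero (mulHom δ)) f
    mul_zero := fun f => map_zero (mulHom δ f) }

instance : Algebra F (DiffPoly δ) :=
  Algebra.ofModule
    (fun c f g => LinearMap.congr_fun (map_smul (mulHom δ) c f) g)
    (fun c f g => map_smul (mulHom δ f) c g)

theorem C_mul_C (a b : A) : C δ a * C δ b = C δ (a * b) := by
  change mulHom δ (Polynomial.C a) (Polynomial.C b) = Polynomial.C (a * b)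
  rw [← Polynomial.monomial_zero_left, mulHom_monomial, pow_zero, Module.End.one_apply,
    Polynomial.smul_C, smul_eq_mul]

theorem t_mul (g : DiffPoly δ) : t δ * g = tMul δ g := by
  have h : ∀ q : A[X], mulHom δ Polynomial.X q = tMul δ q := fun q => by
    rw [← Polynomial.monomial_one_one_eq_X, mulHom_monomial, one_smul, pow_one]
  exact h g

theorem t_pow (n : ℕ) : t δ ^ n = (Polynomial.X ^ n : A[X]) := by
  induction n with
  | zero => rw [pow_zero, pow_zero]; rfl
  | succ n ih =>
    have h : tMul δ (Polynomial.X ^ n : A[X]) = Polynomial.X ^ (n + 1) := by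
      rw [← Polynomial.monomial_one_right_eq_X_pow, tMul_monomial, deriv_one,
        ← Polynomial.monomial_one_right_eq_X_pow]
      simp
    rw [pow_succ', t_mul, ih]
    exact h

theorem C_mul_t_pow (n : ℕ) (a : A) : C δ a * t δ ^ n = Polynomial.monomial n a := by
  rw [t_pow]
  change mulHom δ (Polynomial.C a) _ = _
  rw [← Polynomial.monomial_zero_left, mulHom_monomial, pow_zero, Module.End.one_apply,
    ← Polynomial.monomial_one_right_eq_X_pow, Polynomial.smul_monomial, smul_eq_mul, mul_one]

/-- The defining relation `t a = a t + δ a`. -/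
theorem t_mul_C (a : A) : t δ * C δ a = C δ a * t δ + C δ (δ.toLinearMap a) := by
  have h := C_mul_t_pow δ 1 a
  rw [pow_one] at h
  rw [h, t_mul]
  exact tMul_monomial δ 0 a

variable {δ}

/-- The coefficient of `tⁿ` (coefficients on the left). -/
def coeff (f : DiffPoly δ) (n : ℕ) : A := Polynomial.coeff (R := A) f n

/-- The degree (with `natDeg 0 = 0`). -/
def natDeg (f : DiffPoly δ) : ℕ := Polynomial.natDegree (R := A) f

/-- The leading coefficient is `1`. -/
def Monic (f : DiffPoly δ) : Prop := Polynomial.Monic (R := A) f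

/-- The submodule `R_m` of the differential polynomials of degree less than `m`. -/
def degLT (δ : NCDerivation F A) (m : ℕ) : Submodule F (DiffPoly δ) :=
  (Polynomial.degreeLT A m).restrictScalars F

theorem mem_degLT {m : ℕ} {f : DiffPoly δ} :
    f ∈ degLT δ m ↔ ∀ k, m ≤ k → coeff f k = 0 := by
  have h : ∀ q : A[X], q ∈ Polynomial.degreeLT A m ↔ ∀ k, m ≤ k → q.coeff k = 0 := fun q => by
    rw [Polynomial.mem_degreeLT, Polynomial.degree_lt_iff_coeff_zero]
  exact h f

theorem coeff_tMul_succ (g : A[X]) (k : ℕ) : (tMul δ g).coeff (k + 1) =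
    g.coeff k + δ.toLinearMap (g.coeff (k + 1)) := by
  induction g using Polynomial.induction_on' with
  | add p q hp hq => simp only [map_add, Polynomial.coeff_add, hp, hq]; abel
  | monomial n b =>
    rw [tMul_monomial, Polynomial.coeff_add, Polynomial.coeff_monomial, Polynomial.coeff_monomial,
      Polynomial.coeff_monomial, Polynomial.coeff_monomial]
    congr 1
    · simp
    · split_ifs <;> simp

theorem tMul_pow_top (f : A[X]) (m : ℕ) (hm : f.coeff m = 1)
    (hf : ∀ k, m < k → f.coeff k = 0) (i : ℕ) :
    ((tMul δ ^ i) f).coeff (m + i) = 1 ∧ ∀ k, m + i < k → ((tMul δ ^ i) f).coeff k = 0 := by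
  induction i with
  | zero => exact ⟨by simpa using hm, by simpa using hf⟩
  | succ i ih =>
    rw [pow_succ', Module.End.mul_apply]
    constructor
    · rw [← add_assoc, coeff_tMul_succ, ih.1, ih.2 _ (Nat.lt_succ_self _), map_zero, add_zero]
    · intro k hk
      obtain ⟨k, rfl⟩ : ∃ j, k = j + 1 := ⟨k - 1, by omega⟩
      rw [coeff_tMul_succ, ih.2 _ (by omega), ih.2 _ (by omega), map_zero, add_zero]

theorem mulHom_top (f : A[X]) (m : ℕ) (hm : f.coeff m = 1)
    (hf : ∀ k, m < k → f.coeff k = 0) (q : A[X]) (n : ℕ) (hq : ∀ k, n < k → q.coeff k = 0) :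
    (mulHom δ q f).coeff (m + n) = q.coeff n := by
  have hsum : mulHom δ q f = ∑ i ∈ Finset.range (n + 1), q.coeff i • (tMul δ ^ i) f := by
    have hn : q.natDegree < n + 1 :=
      Nat.lt_succ_of_le (Polynomial.natDegree_le_iff_coeff_eq_zero.2 fun k hk => hq k hk)
    conv_lhs => rw [Polynomial.as_sum_range' q (n + 1) hn]
    rw [map_sum, LinearMap.sum_apply]
    exact Finset.sum_congr rfl fun i _ => mulHom_monomial δ i _ f
  rw [hsum, Polynomial.finsetSum_coeff, Finset.sum_range_succ, Finset.sum_eq_zero, zero_add,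
    Polynomial.coeff_smul, (tMul_pow_top f m hm hf n).1, smul_eq_mul, mul_one]
  intro i hi
  rw [Polynomial.coeff_smul, (tMul_pow_top f m hm hf i).2 _ (by
    have := Finset.mem_range.1 hi; omega), smul_zero]

/-- Existence and uniqueness of the remainder of right division by a monic `f`. -/
theorem existsUnique_rem (f : DiffPoly δ) (hf : f.Monic) (g : DiffPoly δ) :
    ∃! r : DiffPoly δ, r ∈ degLT δ f.natDeg ∧ ∃ q : DiffPoly δ, g = q * f + r := by
  have hm : Polynomial.coeff (R := A) f f.natDeg = 1 := hf
  have htop : ∀ k, f.natDeg < k → Polynomial.coeff (R := A) f k = 0 := fun k hk =>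
    Polynomial.coeff_eq_zero_of_natDegree_lt hk
  have hex : ∀ (n : ℕ) (g : DiffPoly δ), g ∈ degLT δ (f.natDeg + n) →
      ∃ r : DiffPoly δ, r ∈ degLT δ f.natDeg ∧ ∃ q : DiffPoly δ, g = q * f + r := by
    intro n
    induction n with
    | zero => exact fun g hg => ⟨g, hg, 0, by rw [zero_mul, zero_add]⟩
    | succ n ih =>
      intro g hg
      rw [mem_degLT] at hg
      let a : DiffPoly δ := Polynomial.monomial n (coeff g (f.natDeg + n))
      obtain ⟨r, hr, q, hq⟩ := ih (g - a * f) (by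
        rw [mem_degLT]
        intro k hk
        have h1 : coeff (a * f) k = coeff g (f.natDeg + n) *
            Polynomial.coeff ((tMul δ ^ n) (show A[X] from f)) k := by
          change Polynomial.coeff (mulHom δ (Polynomial.monomial n _) (show A[X] from f)) k = _
          rw [mulHom_monomial, Polynomial.coeff_smul, smul_eq_mul]
        refine (Polynomial.coeff_sub (R := A) g (a * f : DiffPoly δ) k).trans ?_
        refine (congrArg (fun c => coeff g k - c) h1).trans ?_
        rcases hk.eq_or_lt with rfl | hk
        · rw [(tMul_pow_top f _ hm htop n).1, mul_one, sub_self]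
        · rw [(tMul_pow_top f _ hm htop n).2 k hk, mul_zero, sub_zero]
          exact hg k (by omega))
      exact ⟨r, hr, q + a, by rw [add_mul, add_right_comm, ← hq, sub_add_cancel]⟩
  obtain ⟨r, hr, q, hq⟩ := hex (g.natDeg + 1) g (by
    rw [mem_degLT]
    intro k hk
    exact Polynomial.coeff_eq_zero_of_natDegree_lt (R := A)
      (show Polynomial.natDegree (R := A) g < k by change g.natDeg < k; omega))
  refine ⟨r, ⟨hr, q, hq⟩, ?_⟩
  rintro r' ⟨hr', q', hq'⟩
  have key : (q' - q) * f = r - r' := by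
    rw [sub_mul, sub_eq_sub_iff_add_eq_add, ← hq', hq, add_comm]
  have hd : r - r' ∈ degLT δ f.natDeg := Submodule.sub_mem _ hr hr'
  have hz : ∀ n, Polynomial.coeff (R := A) (q' - q) n = 0 := by
    by_contra hne
    have h0 : (show A[X] from (q' - q)) ≠ 0 := fun h => hne fun n => by
      change Polynomial.coeff (show A[X] from (q' - q)) n = 0
      rw [h]; simp
    refine h0 (Polynomial.leadingCoeff_eq_zero.1 ?_)
    have h1 := mulHom_top (δ := δ) f f.natDeg hm htop (show A[X] from (q' - q))
      (Polynomial.natDegree (show A[X] from (q' - q)))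
      (fun k hk => Polynomial.coeff_eq_zero_of_natDegree_lt hk)
    refine h1.symm.trans ?_
    change coeff ((q' - q) * f) _ = 0
    rw [key]
    exact mem_degLT.1 hd _ (by omega)
  have hq0 : q' - q = 0 := Polynomial.ext fun n => (hz n).trans (Polynomial.coeff_zero n).symm
  rw [hq0, zero_mul] at key
  exact (sub_eq_zero.1 key.symm).symm

/-- `g mod_r f`: the remainder of right division of `g` by the monic polynomial `f`, i.e. the
`r` of degree less than `deg f` with `g = q f + r` for some `q`. -/
def modR (f : DiffPoly δ) (hf : f.Monic) (g : DiffPoly δ) : DiffPoly δ :=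
  (existsUnique_rem f hf g).choose

theorem modR_mem (f : DiffPoly δ) (hf : f.Monic) (g : DiffPoly δ) :
    modR f hf g ∈ degLT δ f.natDeg := (existsUnique_rem f hf g).choose_spec.1.1

theorem modR_eq (f : DiffPoly δ) (hf : f.Monic) (g : DiffPoly δ) :
    ∃ q : DiffPoly δ, g = q * f + modR f hf g := (existsUnique_rem f hf g).choose_spec.1.2

theorem modR_unique (f : DiffPoly δ) (hf : f.Monic) (g r q : DiffPoly δ)
    (hr : r ∈ degLT δ f.natDeg) (h : g = q * f + r) : modR f hf g = r :=
  (existsUnique_rem f hf g).unique ⟨modR_mem f hf g, modR_eq f hf g⟩ ⟨hr, q, h⟩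

theorem modR_add (f : DiffPoly δ) (hf : f.Monic) (g h : DiffPoly δ) :
    modR f hf (g + h) = modR f hf g + modR f hf h := by
  obtain ⟨q, hq⟩ := modR_eq f hf g
  obtain ⟨q', hq'⟩ := modR_eq f hf h
  refine modR_unique f hf _ _ (q + q') (Submodule.add_mem _ (modR_mem _ _ _) (modR_mem _ _ _)) ?_
  conv_lhs => rw [hq, hq']
  rw [add_mul]; abel

theorem modR_smul (f : DiffPoly δ) (hf : f.Monic) (c : F) (g : DiffPoly δ) :
    modR f hf (c • g) = c • modR f hf g := by
  obtain ⟨q, hq⟩ := modR_eq f hf g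
  refine modR_unique f hf _ _ (c • q) (Submodule.smul_mem _ _ (modR_mem _ _ _)) ?_
  conv_lhs => rw [hq]
  rw [smul_add, smul_mul_assoc]

theorem modR_zero (f : DiffPoly δ) (hf : f.Monic) : modR f hf 0 = 0 :=
  modR_unique f hf _ _ 0 (Submodule.zero_mem _) (by rw [zero_mul, add_zero])

theorem modR_of_mem (f : DiffPoly δ) (hf : f.Monic) (g : DiffPoly δ)
    (hg : g ∈ degLT δ f.natDeg) : modR f hf g = g :=
  modR_unique f hf _ _ 0 hg (by rw [zero_mul, zero_add])

/-- The element `V_p(b)` of `A` with `(t - b)ᵖ = tᵖ - V_p(b)`, see `sub_C_pow`. -/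
def V (δ : NCDerivation F A) (p : ℕ) (b : A) : A := coeff (t δ ^ p - (t δ - C δ b) ^ p) 0

/-- The map `G_{id,c} : ∑ aᵢ tⁱ ↦ ∑ aᵢ (t + c)ⁱ`. -/
def shift (c : A) (f : DiffPoly δ) : DiffPoly δ :=
  Polynomial.sum (R := A) f fun i a => C δ a * (t δ + C δ c) ^ i

theorem monic_pow_sub (δ : NCDerivation F A) (p : ℕ) (hp : 1 < p) (d : A) :
    (t δ ^ p - t δ - C δ d).Monic := by
  obtain ⟨n, rfl⟩ : ∃ n, p = n + 1 := ⟨p - 1, by omega⟩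
  have h : Polynomial.Monic (Polynomial.X ^ (n + 1) - (Polynomial.X + Polynomial.C d) : A[X]) := by
    refine Polynomial.monic_X_pow_sub ((Polynomial.degree_add_le _ _).trans_lt (max_lt ?_ ?_))
    · exact Polynomial.degree_X_le.trans_lt (by exact_mod_cast hp)
    · exact Polynomial.degree_C_le.trans_lt (by exact_mod_cast Nat.succ_pos n)
  rw [sub_sub, t_pow]
  exact h

/-- The formula `(t - b)ᵖ = tᵖ - V_p(b)` in characteristic `p`. -/
theorem sub_C_pow (δ : NCDerivation F A) (p : ℕ) [hp : Fact p.Prime] [CharP F p] (b : A) :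
    (t δ - C δ b) ^ p = t δ ^ p - C δ (V δ p b) := by
  let S : Module.End F A[X] := LinearMap.mulLeft F Polynomial.X
  let B : Module.End F A[X] := Polynomial.lsum fun i =>
    ((Polynomial.monomial i : A →ₗ[A] A[X]).restrictScalars F) ∘ₗ
      (δ.toLinearMap - LinearMap.mulLeft F b)
  have hS : ∀ i a, S (Polynomial.monomial i a) = Polynomial.monomial (i + 1) a := fun i a => by
    change Polynomial.X * _ = _
    rw [Polynomial.X_mul_monomial]
  have hB : ∀ i a, B (Polynomial.monomial i a) =
      Polynomial.monomial i (δ.toLinearMap a - b * a) := fun i a => by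
    simp [B, Polynomial.lsum_apply, Polynomial.sum_monomial_index]
  have hext : ∀ M N : Module.End F A[X],
      (∀ i a, M (Polynomial.monomial i a) = N (Polynomial.monomial i a)) → M = N := by
    intro M N h
    ext1 f
    induction f using Polynomial.induction_on' with
    | add p q hp hq => rw [map_add, map_add, hp, hq]
    | monomial n a => exact h n a
  have hcomm : Commute S B := hext _ _ fun i a => by
    rw [Module.End.mul_apply, Module.End.mul_apply, hS, hB, hB, hS]
  have hN : mulHom δ (t δ - C δ b) = S + B := hext _ _ fun i a => by
    have h : mulHom δ (Polynomial.X - Polynomial.C b) (Polynomial.monomial i a) =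
        (S + B) (Polynomial.monomial i a) := by
      rw [map_sub, LinearMap.sub_apply, ← Polynomial.monomial_one_one_eq_X,
        ← Polynomial.monomial_zero_left, mulHom_monomial, mulHom_monomial, one_smul, pow_one,
        pow_zero, Module.End.one_apply, tMul_monomial, LinearMap.add_apply, hS, hB,
        Polynomial.smul_monomial, smul_eq_mul, map_sub]
      abel
    exact h
  have hpow : ∀ n : ℕ, (t δ - C δ b) ^ n = ((S + B) ^ n) (1 : A[X]) := by
    intro n
    induction n with
    | zero => rfl
    | succ n ih =>
      rw [pow_succ', pow_succ', Module.End.mul_apply, ← ih, ← hN]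
      rfl
  have hp0 : (p : Module.End F A[X]) = 0 := by
    rw [← map_natCast (algebraMap F (Module.End F A[X])), CharP.cast_eq_zero, map_zero]
  have hSp : ∀ n : ℕ, (S ^ n) (1 : A[X]) = Polynomial.X ^ n := by
    intro n
    induction n with
    | zero => rfl
    | succ n ih => rw [pow_succ', pow_succ', Module.End.mul_apply, ih]; rfl
  have hBp : ∀ n : ℕ, ∃ c : A, (B ^ n) (1 : A[X]) = Polynomial.C c := by
    intro n
    induction n with
    | zero => exact ⟨1, rfl⟩
    | succ n ih =>
      obtain ⟨c, hc⟩ := ih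
      refine ⟨δ.toLinearMap c - b * c, ?_⟩
      rw [pow_succ', Module.End.mul_apply, hc, ← Polynomial.monomial_zero_left,
        ← Polynomial.monomial_zero_left, hB]
  obtain ⟨r, hr⟩ := hcomm.exists_add_pow_prime_eq hp.out
  obtain ⟨c, hc⟩ := hBp p
  have key : (t δ - C δ b) ^ p = t δ ^ p + C δ c := by
    rw [hpow, hr, hp0, zero_mul, zero_mul, zero_mul, add_zero, LinearMap.add_apply, hSp, hc, t_pow]
    rfl
  have hV : V δ p b = -c := by
    unfold V
    rw [key, sub_add_cancel_left]
    exact (Polynomial.coeff_neg (Polynomial.C c) 0).trans (by rw [Polynomial.coeff_C_zero])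
  rw [hV, key]
  have hneg : C δ (-c) = -C δ c := Polynomial.C_neg
  rw [hneg, sub_neg_eq_add]

end DiffPoly

/-- The Petit algebra `S_f = A[t;δ]/A[t;δ]f` of a monic `f` of degree `m`: the differential
polynomials of degree less than `m`, with the multiplication `g ∘ h = g h mod_r f`. -/
def PetitAlgebra {δ : NCDerivation F A} (f : DiffPoly δ) (_hf : f.Monic) : Type _ :=
  DiffPoly.degLT δ f.natDeg

namespace PetitAlgebra

variable {δ : NCDerivation F A} (f : DiffPoly δ) (hf : f.Monic)

instance : AddCommGroup (PetitAlgebra f hf) :=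
  inferInstanceAs (AddCommGroup (DiffPoly.degLT δ f.natDeg))
instance : Module F (PetitAlgebra f hf) :=
  inferInstanceAs (Module F (DiffPoly.degLT δ f.natDeg))

/-- The class of a differential polynomial in `S_f`. -/
def mk (g : DiffPoly δ) : PetitAlgebra f hf := ⟨DiffPoly.modR f hf g, DiffPoly.modR_mem f hf g⟩

variable {f hf}

/-- The representative of degree less than `deg f`. -/
def rep (x : PetitAlgebra f hf) : DiffPoly δ := Subtype.val x

variable (f hf)

instance : Mul (PetitAlgebra f hf) := ⟨fun x y => mk f hf (x.rep * y.rep)⟩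
instance : One (PetitAlgebra f hf) := ⟨mk f hf 1⟩

theorem ext_rep {x y : PetitAlgebra f hf} (h : x.rep = y.rep) : x = y := Subtype.ext h

theorem rep_mul (x y : PetitAlgebra f hf) : (x * y).rep = DiffPoly.modR f hf (x.rep * y.rep) := rfl

theorem modR_rep (x : PetitAlgebra f hf) : DiffPoly.modR f hf x.rep = x.rep :=
  DiffPoly.modR_of_mem f hf _ x.2

theorem rep_one_or : (1 : PetitAlgebra f hf).rep = 1 ∨ Subsingleton (PetitAlgebra f hf) := by
  rcases Nat.eq_zero_or_pos f.natDeg with h | h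
  · right
    refine ⟨fun x y => ext_rep f hf ?_⟩
    have hz : ∀ z : PetitAlgebra f hf, z.rep = 0 := fun z =>
      Polynomial.ext fun n => (DiffPoly.mem_degLT.1 z.2 n (by omega)).trans
        (Polynomial.coeff_zero n).symm
    rw [hz, hz]
  · left
    refine DiffPoly.modR_of_mem f hf _ (DiffPoly.mem_degLT.2 fun k hk => ?_)
    change Polynomial.coeff (1 : A[X]) k = 0
    rw [Polynomial.coeff_one, if_neg (by omega)]

instance : NonAssocRing (PetitAlgebra f hf) :=
  { (inferInstance : AddCommGroup (PetitAlgebra f hf)) with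
    mul := (· * ·)
    one := 1
    left_distrib := fun x y z => ext_rep f hf <|
      (congrArg _ (mul_add x.rep y.rep z.rep)).trans (DiffPoly.modR_add f hf _ _)
    right_distrib := fun x y z => ext_rep f hf <|
      (congrArg _ (add_mul x.rep y.rep z.rep)).trans (DiffPoly.modR_add f hf _ _)
    zero_mul := fun x => ext_rep f hf <|
      (congrArg _ (zero_mul x.rep)).trans (DiffPoly.modR_zero f hf)
    mul_zero := fun x => ext_rep f hf <|
      (congrArg _ (mul_zero x.rep)).trans (DiffPoly.modR_zero f hf)
    one_mul := fun x => by
      rcases rep_one_or f hf with h | h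
      · exact ext_rep f hf (by rw [rep_mul, h, one_mul, modR_rep])
      · exact Subsingleton.elim _ _
    mul_one := fun x => by
      rcases rep_one_or f hf with h | h
      · exact ext_rep f hf (by rw [rep_mul, h, mul_one, modR_rep])
      · exact Subsingleton.elim _ _ }

instance : IsScalarTower F (PetitAlgebra f hf) (PetitAlgebra f hf) :=
  ⟨fun c x y => ext_rep f hf <|
    (congrArg _ (smul_mul_assoc c x.rep y.rep)).trans (DiffPoly.modR_smul f hf _ _)⟩

instance : SMulCommClass F (PetitAlgebra f hf) (PetitAlgebra f hf) :=
  ⟨fun c x y => ext_rep f hf <|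
    ((congrArg _ (mul_smul_comm c x.rep y.rep)).trans (DiffPoly.modR_smul f hf _ _)).symm⟩

end PetitAlgebra

/-- The algebra `(A, δ, d) = A[t;δ]/A[t;δ](tᵖ - t - d)`. -/
abbrev DiffExt (δ : NCDerivation F A) (p : ℕ) [hp : Fact p.Prime] (d : A) : Type _ :=
  PetitAlgebra (DiffPoly.t δ ^ p - DiffPoly.t δ - DiffPoly.C δ d)
    (DiffPoly.monic_pow_sub δ p hp.out.one_lt d)

end DiffPoly

/-- A nonassociative ring is a division algebra if it is nonzero and left and right
multiplication by every nonzero element are bijective. -/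
def IsDivisionAlgebra (A : Type*) [NonUnitalNonAssocRing A] : Prop :=
  Nontrivial A ∧ ∀ a : A, a ≠ 0 →
    Function.Bijective (fun x : A => a * x) ∧ Function.Bijective (fun x : A => x * a)

/-- The group `Aut_F(A)` of `F`-algebra automorphisms of a nonassociative `F`-algebra. -/
def NAAut (F A : Type*) [CommRing F] [NonUnitalNonAssocRing A] [Module F A] :
    Subgroup (A ≃ₗ[F] A) where
  carrier := {g | ∀ x y, g (x * y) = g x * g y}
  mul_mem' := fun {g h} hg hh x y => by
    change g (h (x * y)) = g (h x) * g (h y)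
    rw [hh, hg]
  one_mem' := fun _ _ => rfl
  inv_mem' := fun {g} hg x y => g.injective (by
    change g (g.symm (x * y)) = g (g.symm x * g.symm y)
    rw [hg, LinearEquiv.apply_symm_apply, LinearEquiv.apply_symm_apply,
      LinearEquiv.apply_symm_apply])

end

/-! Write `A = D ⊗ E` and `R = A[t;δ]`, and let `f = tᵖ - t - d`. The core is the division criterion
for `R/Rf`. Since `(t - z)ᵖ = tᵖ - V_p(z)`, dividing `f` on the right by `t - z` leaves the constant
`V_p(z) - z - d`, so the condition on `d` says exactly that `f` has no monic linear right factor
(`t_pow_sub_mem_span_iff`). Such a factor excludes division: a left inverse of `t - z` modulo `f`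
would put `1` into `R(t - z)`.

The converse rests on the automorphism `σ : t ↦ t - 1` of `R`, which fixes `f` and satisfies `σᵖ =
1` in characteristic `p`. Left ideals of `R` are principal because `A` is a division ring. Let `Rh`
be a maximal left ideal containing `f`, and let `N = Ru` be the intersection of its `σ`-conjugates.
Then `u` is fixed by `σ`, and the coefficient below the leading one forces `p ∣ deg u`
(`natDeg_cast_eq_zero`); as `f ∈ N` and `N` is proper, `deg u = p`. A finite intersection of maximal
left ideals of equal codimension has codimension a multiple of it (`dvd_finrank_quotient_iInf`), so
`deg h` divides `p`. Degree `1` is excluded, hence `h = f` and `Rf` is maximal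
(`isMaximal_span_t_pow_sub`). Maximality rules out zero divisors by a dimension count
(`eq_zero_of_mul_mem_span`), and finite dimension does the rest.

The tensor isomorphism comes from `E[t;δ] ⊗ D → D_E[t;δ]`: constants from `D` commute with the image
of `E[t;δ]`, so reduction modulo `f` is respected. It is onto, and both sides have the same
dimension. Finally `[E:F] = p`, since the eigenspaces of `δ` are at most lines and `Xᵖ - X` has `p`
distinct roots in `F`. The automorphism `G` is `σ` transported through the isomorphism. -/

noncomputable section

namespace DiffPoly

/-! ### Coefficients, the universal property, and the automorphism `t ↦ t - 1`. -/

section Basic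

variable {F A : Type*} [CommRing F] [Ring A] [Algebra F A] {δ : NCDerivation F A}

theorem ext_coeff {f g : DiffPoly δ} (h : ∀ n, coeff f n = coeff g n) : f = g :=
  Polynomial.ext h

theorem coeff_add (f g : DiffPoly δ) (n : ℕ) : coeff (f + g) n = coeff f n + coeff g n :=
  Polynomial.coeff_add (R := A) f g n

theorem coeff_sub (f g : DiffPoly δ) (n : ℕ) : coeff (f - g) n = coeff f n - coeff g n :=
  Polynomial.coeff_sub (R := A) f g n

theorem coeff_C_mul (a : A) (f : DiffPoly δ) (n : ℕ) : coeff (C δ a * f) n = a * coeff f n := by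
  change Polynomial.coeff (mulHom δ (Polynomial.C a) (show A[X] from f)) n = _
  rw [← Polynomial.monomial_zero_left, mulHom_monomial, pow_zero, Module.End.one_apply,
    Polynomial.coeff_smul, smul_eq_mul]
  rfl

theorem coeff_C (a : A) (n : ℕ) : coeff (C δ a) n = if n = 0 then a else 0 :=
  Polynomial.coeff_C

theorem coeff_t_pow (i n : ℕ) : coeff (t δ ^ i) n = if n = i then 1 else 0 := by
  rw [t_pow]
  exact Polynomial.coeff_X_pow i n

theorem coeff_t_mul_succ (f : DiffPoly δ) (k : ℕ) :
    coeff (t δ * f) (k + 1) = coeff f k + δ.toLinearMap (coeff f (k + 1)) := by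
  rw [t_mul]
  exact coeff_tMul_succ _ k

theorem C_add (a b : A) : C δ (a + b) = C δ a + C δ b := Polynomial.C_add

theorem C_sub (a b : A) : C δ (a - b) = C δ a - C δ b := Polynomial.C_sub

theorem C_neg (a : A) : C δ (-a) = -C δ a := Polynomial.C_neg

theorem C_one : C δ 1 = 1 := Polynomial.C_1

theorem C_zero : C δ 0 = 0 := Polynomial.C_0

theorem C_injective : Function.Injective (C δ) := Polynomial.C_injective

variable (δ) in
/-- The embedding of the coefficients as constant polynomials. -/
def CHom : A →ₐ[F] DiffPoly δ where
  toFun := C δ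
  map_one' := C_one
  map_mul' a b := (C_mul_C δ a b).symm
  map_zero' := C_zero
  map_add' := C_add
  commutes' c := by
    rw [Algebra.algebraMap_eq_smul_one, Algebra.algebraMap_eq_smul_one, ← C_one]
    exact (Polynomial.smul_C c 1).symm

theorem CHom_apply (a : A) : CHom δ a = C δ a := rfl

theorem eq_sum {f : DiffPoly δ} {m : ℕ} (hf : f ∈ degLT δ m) :
    f = ∑ i ∈ Finset.range m, C δ (coeff f i) * t δ ^ i := by
  refine ext_coeff fun n => ?_
  have h : ∀ s : Finset ℕ, coeff (∑ i ∈ s, C δ (coeff f i) * t δ ^ i) n =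
      ∑ i ∈ s, coeff (C δ (coeff f i) * t δ ^ i) n := fun s =>
    Polynomial.finsetSum_coeff (R := A) s _ n
  rw [h]
  simp only [coeff_C_mul, coeff_t_pow, mul_ite, mul_one, mul_zero, Finset.sum_ite_eq,
    Finset.mem_range]
  split_ifs with hn
  · rfl
  · exact mem_degLT.1 hf n (by omega)

theorem mem_degLT_natDeg_add_one (f : DiffPoly δ) : f ∈ degLT δ (f.natDeg + 1) :=
  mem_degLT.2 fun k hk => Polynomial.coeff_eq_zero_of_natDegree_lt (R := A)
    (show Polynomial.natDegree (R := A) f < k from hk)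

theorem mem_degLT_of_natDeg_lt {f : DiffPoly δ} {m : ℕ} (h : f.natDeg < m) : f ∈ degLT δ m :=
  mem_degLT.2 fun k hk => mem_degLT.1 (mem_degLT_natDeg_add_one f) k (by omega)

theorem induction_on {P : DiffPoly δ → Prop} (f : DiffPoly δ)
    (hadd : ∀ f g, P f → P g → P (f + g)) (hmon : ∀ i a, P (C δ a * t δ ^ i)) : P f := by
  rw [eq_sum (mem_degLT_natDeg_add_one f)]
  refine Finset.sum_induction _ P hadd ?_ fun i _ => hmon i _
  simpa [C_zero] using hmon 0 0

theorem algHom_ext {B : Type*} [Ring B] [Algebra F B] {φ ψ : DiffPoly δ →ₐ[F] B}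
    (hC : ∀ a, φ (C δ a) = ψ (C δ a)) (ht : φ (t δ) = ψ (t δ)) : φ = ψ := by
  ext f
  induction f using induction_on with
  | hadd f g hf hg => rw [map_add, map_add, hf, hg]
  | hmon i a => rw [map_mul, map_mul, map_pow, map_pow, hC, ht]

variable (δ) in
/-- The universal property of `A[t;δ]`: the homomorphism which is `φ` on the constants and sends
`t` to an element `y` with `y φ(a) = φ(a) y + φ(δ a)`. -/
def liftHom {B : Type*} [Ring B] [Algebra F B] (φ : A →ₐ[F] B) (y : B)
    (hy : ∀ a, y * φ a = φ a * y + φ (δ.toLinearMap a)) : DiffPoly δ →ₐ[F] B :=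
  let L : A[X] →ₗ[F] B :=
    Polynomial.lsum fun i => (LinearMap.mulRight F (y ^ i)) ∘ₗ φ.toLinearMap
  have hL : ∀ i a, L (Polynomial.monomial i a) = φ a * y ^ i := fun i a => by
    simp [L, Polynomial.lsum_apply, Polynomial.sum_monomial_index]
  have hsmul : ∀ (a : A) (g : A[X]), L (a • g) = φ a * L g := fun a g => by
    induction g using Polynomial.induction_on' with
    | add p q hp hq => rw [smul_add, map_add, hp, hq, map_add, mul_add]
    | monomial i b =>
      rw [Polynomial.smul_monomial, hL, hL, smul_eq_mul, map_mul, mul_assoc]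
  -- The commutation rule `hy` enters only here: `L` turns left multiplication by `t` into left
  -- multiplication by `y`.
  have htm : ∀ g : A[X], L (tMul δ g) = y * L g := fun g => by
    induction g using Polynomial.induction_on' with
    | add p q hp hq => rw [map_add, map_add, hp, hq, map_add, mul_add]
    | monomial i b =>
      rw [tMul_monomial, map_add, hL, hL, hL, ← mul_assoc, hy, add_mul, pow_succ', mul_assoc]
  have htp : ∀ (i : ℕ) (g : A[X]), L ((tMul δ ^ i) g) = y ^ i * L g := fun i g => by
    induction i with
    | zero => simp
    | succ i ih => rw [pow_succ', Module.End.mul_apply, htm, ih, pow_succ', mul_assoc]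
  AlgHom.ofLinearMap (A := DiffPoly δ) L
    ((hL 0 1).trans (by rw [map_one, pow_zero, one_mul])) fun f g => by
      have h : ∀ f g : A[X], L (mulHom δ f g) = L f * L g := fun f g => by
        induction f using Polynomial.induction_on' with
        | add p q hp hq => rw [map_add, LinearMap.add_apply, map_add, hp, hq, map_add, add_mul]
        | monomial i b => rw [mulHom_monomial, hsmul, htp, hL, mul_assoc]
      exact h f g

theorem liftHom_sum {B : Type*} [Ring B] [Algebra F B] (φ : A →ₐ[F] B) (y : B)
    (hy : ∀ a, y * φ a = φ a * y + φ (δ.toLinearMap a)) (f : DiffPoly δ) :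
    liftHom δ φ y hy f = Polynomial.sum (R := A) f fun i a => φ a * y ^ i := rfl

theorem liftHom_C {B : Type*} [Ring B] [Algebra F B] (φ : A →ₐ[F] B) (y : B)
    (hy : ∀ a, y * φ a = φ a * y + φ (δ.toLinearMap a)) (a : A) :
    liftHom δ φ y hy (C δ a) = φ a := by
  rw [liftHom_sum]
  refine (Polynomial.sum_C_index (by simp)).trans (by simp)

theorem liftHom_t {B : Type*} [Ring B] [Algebra F B] (φ : A →ₐ[F] B) (y : B)
    (hy : ∀ a, y * φ a = φ a * y + φ (δ.toLinearMap a)) :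
    liftHom δ φ y hy (t δ) = y := by
  rw [liftHom_sum]
  exact (Polynomial.sum_X_index (by simp)).trans (by simp)

variable (δ) in
/-- For central `c`, the map `∑ aᵢ tⁱ ↦ ∑ aᵢ (t + c)ⁱ` is a homomorphism. -/
def shiftHom (c : A) (hc : ∀ a, c * a = a * c) : DiffPoly δ →ₐ[F] DiffPoly δ :=
  liftHom δ (CHom δ) (t δ + C δ c) fun a => by
    rw [CHom_apply, CHom_apply, add_mul, mul_add, t_mul_C, C_mul_C, C_mul_C, hc]
    abel

theorem shiftHom_C (c : A) (hc : ∀ a, c * a = a * c) (a : A) :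
    shiftHom δ c hc (C δ a) = C δ a := liftHom_C _ _ _ a

theorem shiftHom_t (c : A) (hc : ∀ a, c * a = a * c) :
    shiftHom δ c hc (t δ) = t δ + C δ c := liftHom_t _ _ _

theorem shiftHom_shiftHom (c c' : A) (hc : ∀ a, c * a = a * c) (hc' : ∀ a, c' * a = a * c')
    (f : DiffPoly δ) : shiftHom δ c hc (shiftHom δ c' hc' f) =
      shiftHom δ (c + c') (fun a => by rw [add_mul, mul_add, hc, hc']) f := by
  rw [← AlgHom.comp_apply]
  refine DFunLike.congr_fun (algHom_ext (fun a => ?_) ?_) f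
  · rw [AlgHom.comp_apply, shiftHom_C, shiftHom_C, shiftHom_C]
  · rw [AlgHom.comp_apply, shiftHom_t, shiftHom_t, map_add, shiftHom_t, shiftHom_C, C_add,
      add_assoc]

/-- The vanishing of `c` is a hypothesis so that the sums `-1 + 1` and `1 + -1` fit without
rewriting inside the centrality proof. -/
theorem shiftHom_zero (c : A) (hc : ∀ a, c * a = a * c) (h0 : c = 0) (f : DiffPoly δ) :
    shiftHom δ c hc f = f := by
  refine DFunLike.congr_fun (algHom_ext (ψ := AlgHom.id F _) (fun a => ?_) ?_) f
  · rw [shiftHom_C]; rfl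
  · rw [shiftHom_t, h0, C_zero, add_zero]; rfl

variable (δ) in
/-- The automorphism `∑ aᵢ tⁱ ↦ ∑ aᵢ (t - 1)ⁱ`. -/
def shiftEquiv : DiffPoly δ ≃ₐ[F] DiffPoly δ :=
  have h : ∀ a : A, -1 * a = a * -1 := fun a => by rw [neg_mul, mul_neg, one_mul, mul_one]
  have h' : ∀ a : A, 1 * a = a * 1 := fun a => by rw [one_mul, mul_one]
  AlgEquiv.ofAlgHom (shiftHom δ (-1) h) (shiftHom δ 1 h')
    (AlgHom.ext fun f => (shiftHom_shiftHom _ _ h h' f).trans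
      (shiftHom_zero _ _ (neg_add_cancel 1) f))
    (AlgHom.ext fun f => (shiftHom_shiftHom _ _ h' h f).trans
      (shiftHom_zero _ _ (add_neg_cancel 1) f))

theorem shiftEquiv_C (a : A) : shiftEquiv δ (C δ a) = C δ a :=
  shiftHom_C (-1) (fun a => by rw [neg_mul, mul_neg, one_mul, mul_one]) a

theorem shiftEquiv_t : shiftEquiv δ (t δ) = t δ - 1 := by
  rw [sub_eq_add_neg, ← C_one, ← C_neg]
  exact shiftHom_t (-1) fun a => by rw [neg_mul, mul_neg, one_mul, mul_one]

theorem shiftEquiv_pow_t (n : ℕ) : (shiftEquiv δ ^ n) (t δ) = t δ - n := by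
  induction n with
  | zero => simp
  | succ n ih =>
    rw [pow_succ', AlgEquiv.mul_apply, ih, map_sub, shiftEquiv_t, map_natCast, Nat.cast_succ]
    abel

theorem shiftEquiv_pow_C (n : ℕ) (a : A) : (shiftEquiv δ ^ n) (C δ a) = C δ a := by
  induction n with
  | zero => simp
  | succ n ih => rw [pow_succ', AlgEquiv.mul_apply, ih, shiftEquiv_C]

theorem shiftEquiv_pow_char (p : ℕ) [CharP (DiffPoly δ) p] : shiftEquiv δ ^ p = 1 := by
  ext f
  refine DFunLike.congr_fun (algHom_ext (φ := (shiftEquiv δ ^ p).toAlgHom)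
    (ψ := AlgHom.id F _) (fun a => ?_) ?_) f
  · exact shiftEquiv_pow_C p a
  · exact (shiftEquiv_pow_t p).trans (by rw [CharP.cast_eq_zero, sub_zero]; rfl)

/-- The leading coefficients of `(t - 1)ⁿ`. -/
theorem coeff_t_sub_one_pow (n : ℕ) : coeff ((t δ - 1) ^ n) n = 1 ∧
    (∀ k, n < k → coeff ((t δ - 1) ^ n) k = 0) ∧
    (∀ k, k + 1 = n → coeff ((t δ - 1) ^ n) k = -(n : A)) := by
  have h1 : ∀ (f : DiffPoly δ) k, coeff ((t δ - 1) * f) (k + 1) =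
      coeff f k + δ.toLinearMap (coeff f (k + 1)) - coeff f (k + 1) := fun f k => by
    rw [sub_mul, one_mul, coeff_sub, coeff_t_mul_succ]
  have hδ : ∀ n : ℕ, δ.toLinearMap (n : A) = 0 := fun n => by
    rw [← nsmul_one, map_nsmul, deriv_one, smul_zero]
  induction n with
  | zero =>
    have h0 : ∀ k, coeff (1 : DiffPoly δ) k = if k = 0 then 1 else 0 := fun k => by
      rw [← C_one, coeff_C]
    simp only [pow_zero, h0, if_true, true_and]
    exact ⟨fun k hk => if_neg hk.ne', fun k hk => by omega⟩
  | succ n ih =>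
    obtain ⟨i1, i2, i3⟩ := ih
    rw [pow_succ']
    refine ⟨?_, fun k hk => ?_, fun k hk => ?_⟩
    · rw [h1, i1, i2 (n + 1) (by omega)]; simp
    · obtain ⟨k, rfl⟩ : ∃ j, k = j + 1 := ⟨k - 1, by omega⟩
      rw [h1, i2 k (by omega), i2 (k + 1) (by omega)]; simp
    · obtain rfl : k = n := by omega
      -- The recursion `h1` sees only positive indices, so the constant term of `t - 1` is computed
      -- by hand.
      cases k with
      | zero =>
        have h2 : t δ - 1 = C δ 1 * t δ ^ 1 - C δ 1 := by rw [C_one, one_mul, pow_one]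
        rw [pow_zero, mul_one, h2, coeff_sub, coeff_C_mul, coeff_t_pow, coeff_C]
        simp
      | succ k => rw [h1, i1, i3 k rfl, deriv_one]; push_cast; abel

theorem shiftEquiv_mem_degLT {f : DiffPoly δ} {m : ℕ} (hf : f ∈ degLT δ m) :
    shiftEquiv δ f ∈ degLT δ m := by
  rw [eq_sum hf, map_sum]
  refine Submodule.sum_mem _ fun i hi => mem_degLT.2 fun k hk => ?_
  rw [map_mul, shiftEquiv_C, map_pow, shiftEquiv_t, coeff_C_mul,
    (coeff_t_sub_one_pow i).2.1 k (by have := Finset.mem_range.1 hi; omega), mul_zero]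

theorem sub_C_mul_mem_degLT {f : DiffPoly δ} {m : ℕ} (hf : f ∈ degLT δ (m + 1)) :
    f - C δ (coeff f m) * t δ ^ m ∈ degLT δ m := by
  refine mem_degLT.2 fun k hk => ?_
  rw [coeff_sub, coeff_C_mul, coeff_t_pow]
  split_ifs with h
  · subst h; simp
  · rw [mem_degLT.1 hf k (by omega)]; simp

theorem coeff_shiftEquiv {f : DiffPoly δ} {m : ℕ} (hf : f ∈ degLT δ (m + 1)) :
    coeff (shiftEquiv δ f) m = coeff f m := by
  have h : f = (f - C δ (coeff f m) * t δ ^ m) + C δ (coeff f m) * t δ ^ m := by abel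
  conv_lhs => rw [h]
  rw [map_add, coeff_add, mem_degLT.1 (shiftEquiv_mem_degLT (sub_C_mul_mem_degLT hf)) m le_rfl,
    map_mul, map_pow, shiftEquiv_C, shiftEquiv_t, coeff_C_mul, (coeff_t_sub_one_pow m).1, zero_add,
    mul_one]

theorem coeff_shiftEquiv_pred {f : DiffPoly δ} {m : ℕ} (hf : f ∈ degLT δ (m + 2)) :
    coeff (shiftEquiv δ f) m = coeff f m - coeff f (m + 1) * (m + 1 : ℕ) := by
  -- With the top term split off, the rest has degree at most `m` and keeps its `m`-th coefficient;
  -- the correction comes from `(t - 1)ᵐ⁺¹` alone.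
  have h : f = (f - C δ (coeff f (m + 1)) * t δ ^ (m + 1)) +
    C δ (coeff f (m + 1)) * t δ ^ (m + 1) := by abel
  conv_lhs => rw [h]
  rw [map_add, coeff_add, coeff_shiftEquiv (sub_C_mul_mem_degLT hf),
    map_mul, map_pow, shiftEquiv_C, shiftEquiv_t, coeff_C_mul,
    (coeff_t_sub_one_pow (m + 1)).2.2 m rfl, coeff_sub, coeff_C_mul, coeff_t_pow,
    if_neg (by omega), mul_zero, sub_zero, mul_neg, sub_eq_add_neg]

/-- The degree of a monic polynomial fixed by `t ↦ t - 1` vanishes in `A`. -/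
theorem natDeg_cast_eq_zero {u : DiffPoly δ} (hu : u.Monic) (hs : shiftEquiv δ u = u) :
    (u.natDeg : A) = 0 := by
  rcases Nat.eq_zero_or_pos u.natDeg with h | h
  · rw [h, Nat.cast_zero]
  · obtain ⟨m, hm⟩ : ∃ m, u.natDeg = m + 1 := ⟨u.natDeg - 1, by omega⟩
    have h1 := coeff_shiftEquiv_pred (f := u) (m := m) (mem_degLT_of_natDeg_lt (by omega))
    have h2 : coeff u (m + 1) = 1 := by rw [← hm]; exact hu
    rw [hs, h2, one_mul] at h1
    rw [hm]
    exact sub_eq_self.1 h1.symm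

theorem natDeg_t_pow_sub [Nontrivial A] (p : ℕ) (hp : 1 < p) (d : A) :
    (t δ ^ p - t δ - C δ d).natDeg = p := by
  have h : ∀ k, coeff (t δ ^ p - t δ - C δ d) k =
      (if k = p then 1 else 0) - (if k = 1 then 1 else 0) - if k = 0 then d else 0 := fun k => by
    conv_lhs => rw [← pow_one (t δ), ← pow_mul, one_mul]
    rw [coeff_sub, coeff_sub, coeff_t_pow, coeff_t_pow, coeff_C]
  refine Polynomial.natDegree_eq_of_le_of_coeff_ne_zero (p := show A[X] from _) ?_ (?_ : _ ≠ (0 : A))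
  · refine Polynomial.natDegree_le_iff_coeff_eq_zero.2 fun k hk => (h k).trans ?_
    rw [if_neg (by omega), if_neg (by omega), if_neg (by omega)]; simp
  · refine fun h0 => one_ne_zero ((?_ : (1 : A) = _).trans h0)
    refine ((h p).trans ?_).symm
    rw [if_pos rfl, if_neg (by omega), if_neg (by omega)]; simp

/-- By Frobenius `(t - 1)ᵖ = tᵖ - 1`, and this `-1` cancels against the one from `-(t - 1)`. -/
theorem shiftEquiv_t_pow_sub (p : ℕ) [Fact p.Prime] [CharP (DiffPoly δ) p] (d : A) :
    shiftEquiv δ (t δ ^ p - t δ - C δ d) = t δ ^ p - t δ - C δ d := by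
  rw [map_sub, map_sub, map_pow, shiftEquiv_t, shiftEquiv_C,
    sub_pow_char_of_commute p (Commute.one_right _), one_pow]
  abel

theorem natDeg_sub_C [Nontrivial A] (z : A) : (t δ - C δ z).natDeg = 1 :=
  Polynomial.natDegree_X_sub_C z

theorem monic_sub_C (z : A) : (t δ - C δ z).Monic := Polynomial.monic_X_sub_C z

theorem charP_of_field {F A : Type*} [Field F] [Ring A] [Algebra F A] [Nontrivial A]
    (δ : NCDerivation F A) (p : ℕ) [CharP F p] : CharP (DiffPoly δ) p := by
  have : Nontrivial (DiffPoly δ) := C_injective.nontrivial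
  exact charP_of_injective_algebraMap (algebraMap F (DiffPoly δ)).injective p

/-- In a noncommutative ring `Ideal` means left ideal, so the span is the set of left multiples `q *
f`. This links remainders to ideal theory. -/
theorem modR_eq_zero_iff (f : DiffPoly δ) (hf : f.Monic) (g : DiffPoly δ) :
    modR f hf g = 0 ↔ g ∈ Ideal.span {f} := by
  rw [Ideal.mem_span_singleton']
  constructor
  · intro h
    obtain ⟨q, hq⟩ := modR_eq f hf g
    exact ⟨q, by conv_rhs => rw [hq, h, add_zero]⟩
  · rintro ⟨q, rfl⟩
    exact modR_unique f hf _ 0 q (Submodule.zero_mem _) (add_zero _).symm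

theorem eq_zero_of_mem_span {f : DiffPoly δ} (hf : f.Monic) {g : DiffPoly δ}
    (hg : g ∈ Ideal.span {f}) (hd : g ∈ degLT δ f.natDeg) : g = 0 := by
  rw [← modR_of_mem f hf g hd]
  exact (modR_eq_zero_iff f hf g).2 hg

/-- `t - z` is a right divisor of `tᵖ - t - d` exactly if `d = V_p(z) - z`. -/
theorem t_pow_sub_mem_span_iff {F A : Type*} [Field F] [Ring A] [Algebra F A] [Nontrivial A]
    {δ : NCDerivation F A} (p : ℕ) [hp : Fact p.Prime] [CharP F p] (d z : A) :
    t δ ^ p - t δ - C δ d ∈ Ideal.span {t δ - C δ z} ↔ d = V δ p z - z := by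
  -- The explicit right division: replace `tᵖ` by `(t - z)ᵖ + V_p(z)` and `t` by `(t - z) + z`.
  have h : t δ ^ p - t δ - C δ d =
      ((t δ - C δ z) ^ (p - 1) - 1) * (t δ - C δ z) + C δ (V δ p z - z - d) := by
    rw [sub_mul, one_mul, ← pow_succ, Nat.sub_add_cancel hp.out.one_le, sub_C_pow, C_sub, C_sub]
    abel
  rw [← modR_eq_zero_iff _ (monic_sub_C z), modR_unique _ (monic_sub_C z) _ _ _ (mem_degLT.2
    fun k hk => ?_) h]
  · rw [← C_zero, C_injective.eq_iff, sub_eq_zero, eq_comm]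
  · rw [natDeg_sub_C] at hk
    rw [coeff_C, if_neg (by omega)]

end Basic

end DiffPoly

namespace DiffPoly

/-! ### Codimensions of left ideals. -/

section Codim

variable {F R : Type*} [Field F] [Ring R] [Algebra F R]

/-- The Chinese remainder theorem for left ideals, as an isomorphism of modules only. -/
theorem finrank_quotient_inf {I J : Ideal R} (h : I ⊔ J = ⊤) [Module.Finite F (R ⧸ I)]
    [Module.Finite F (R ⧸ J)] : Module.Finite F (R ⧸ I ⊓ J) ∧
    Module.finrank F (R ⧸ I ⊓ J) = Module.finrank F (R ⧸ I) + Module.finrank F (R ⧸ J) := by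
  let f : R →ₗ[R] (R ⧸ I) × (R ⧸ J) := (Submodule.mkQ I).prod (Submodule.mkQ J)
  have hker : LinearMap.ker f = I ⊓ J := by
    rw [LinearMap.ker_prod, Submodule.ker_mkQ, Submodule.ker_mkQ]
  have hsurj : Function.Surjective f := by
    rintro ⟨x, y⟩
    obtain ⟨x, rfl⟩ := Submodule.mkQ_surjective I x
    obtain ⟨y, rfl⟩ := Submodule.mkQ_surjective J y
    obtain ⟨i, hi, j, hj, hij⟩ := Submodule.mem_sup.1 (h ▸ Submodule.mem_top : x - y ∈ I ⊔ J)
    -- Since `x - y = i + j`, this element is also `y + j`.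
    refine ⟨x - i, Prod.ext ?_ ?_⟩
    · have hi' : Submodule.mkQ I i = 0 := (Submodule.Quotient.mk_eq_zero I).2 hi
      change Submodule.mkQ I (x - i) = Submodule.mkQ I x
      rw [map_sub, hi', sub_zero]
    · have hj' : Submodule.mkQ J j = 0 := (Submodule.Quotient.mk_eq_zero J).2 hj
      change Submodule.mkQ J (x - i) = Submodule.mkQ J y
      have : x - i = y + j := by rw [sub_eq_iff_eq_add, add_assoc, add_comm j, hij]; abel
      rw [this, map_add, hj', add_zero]
  have e : (R ⧸ I ⊓ J) ≃ₗ[F] (R ⧸ I) × (R ⧸ J) :=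
    ((Submodule.quotEquivOfEq _ _ hker.symm).trans
      (f.quotKerEquivOfSurjective hsurj)).restrictScalars F
  exact ⟨Module.Finite.equiv e.symm, e.finrank_eq.trans Module.finrank_prod⟩

/-- Each further maximal left ideal either contains the intersection so far, and changes nothing, or
is comaximal with it, and adds `k` to the codimension. -/
theorem dvd_finrank_quotient_iInf {ι : Type*} (s : Finset ι) (J : ι → Ideal R) (k : ℕ)
    (hmax : ∀ i, (J i).IsMaximal) (hfin : ∀ i, Module.Finite F (R ⧸ J i))
    (hk : ∀ i, Module.finrank F (R ⧸ J i) = k) :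
    Module.Finite F (R ⧸ s.inf J) ∧ k ∣ Module.finrank F (R ⧸ s.inf J) := by
  classical
  induction s using Finset.induction_on with
  | empty =>
    rw [Finset.inf_empty]
    have : Subsingleton (R ⧸ (⊤ : Ideal R)) := Submodule.Quotient.subsingleton_iff.2 rfl
    exact ⟨inferInstance, by rw [Module.finrank_zero_of_subsingleton]; exact dvd_zero k⟩
  | insert a s _ ih =>
    rw [Finset.inf_insert]
    by_cases h : s.inf J ≤ J a
    · rwa [inf_eq_right.2 h]
    · have := hfin a
      have := ih.1
      obtain ⟨h1, h2⟩ := finrank_quotient_inf (F := F) ((hmax a).1.2 _ (left_lt_sup.2 h))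
      exact ⟨h1, h2 ▸ (hk a) ▸ dvd_add dvd_rfl (hk a ▸ ih.2)⟩

/-- The map induced by `e` on the quotients is only semilinear over `R`, so scalars are restricted
to `F`. -/
theorem quotient_comap (e : R ≃ₐ[F] R) (J : Ideal R) [Module.Finite F (R ⧸ J)] :
    Module.Finite F (R ⧸ J.comap e) ∧
      Module.finrank F (R ⧸ J.comap e) = Module.finrank F (R ⧸ J) := by
  let E : (R ⧸ (J.comap e).restrictScalars F) ≃ₗ[F] (R ⧸ J.restrictScalars F) :=
    Submodule.Quotient.equiv _ _ e.toLinearEquiv <| by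
      ext x
      constructor
      · rintro ⟨y, hy, rfl⟩
        exact hy
      · intro hx
        exact ⟨e.symm x, by simpa using hx, by simp⟩
  have : Module.Finite F (R ⧸ J.restrictScalars F) := ‹Module.Finite F (R ⧸ J)›
  exact ⟨Module.Finite.equiv E.symm, E.finrank_eq⟩

end Codim

/-! ### Left ideals of `A[t;δ]` and maximality of the one generated by `tᵖ - t - d`. -/

section Ideals

variable {F A : Type*} [Field F] [Ring A] [Algebra F A] {δ : NCDerivation F A}

variable (δ) in
theorem finrank_degLT [FiniteDimensional F A] (m : ℕ) : Module.Finite F (degLT δ m) ∧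
    Module.finrank F (degLT δ m) = m * Module.finrank F A := by
  have e : degLT δ m ≃ₗ[F] (Fin m → A) := (Polynomial.degreeLTEquiv A m).restrictScalars F
  exact ⟨Module.Finite.equiv e.symm, by
    rw [e.finrank_eq, Module.finrank_pi_fintype]; simp⟩

/-- Reduction modulo `f` as a linear map. -/
def modRHom (f : DiffPoly δ) (hf : f.Monic) : DiffPoly δ →ₗ[F] degLT δ f.natDeg where
  toFun g := ⟨modR f hf g, modR_mem f hf g⟩
  map_add' g h := Subtype.ext (modR_add f hf g h)
  map_smul' c g := Subtype.ext (modR_smul f hf c g)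

/-- Remainders identify the quotient with the polynomials of degree less than `deg f`; this converts
degrees into codimensions. -/
theorem finrank_quotient_span [FiniteDimensional F A] {f : DiffPoly δ} (hf : f.Monic) :
    Module.Finite F (DiffPoly δ ⧸ Ideal.span {f}) ∧
      Module.finrank F (DiffPoly δ ⧸ Ideal.span {f}) = f.natDeg * Module.finrank F A := by
  have hker : LinearMap.ker (modRHom f hf) = (Ideal.span {f}).restrictScalars F := by
    ext g
    rw [LinearMap.mem_ker, Submodule.restrictScalars_mem, ← modR_eq_zero_iff f hf]
    exact Subtype.ext_iff
  have hs : Function.Surjective (modRHom f hf) := fun g =>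
    ⟨g, Subtype.ext (modR_of_mem f hf _ g.2)⟩
  have e : (DiffPoly δ ⧸ (Ideal.span {f}).restrictScalars F) ≃ₗ[F] degLT δ f.natDeg :=
    (Submodule.quotEquivOfEq _ _ hker.symm).trans ((modRHom f hf).quotKerEquivOfSurjective hs)
  have := (finrank_degLT δ f.natDeg).1
  exact ⟨Module.Finite.equiv e.symm, e.finrank_eq.trans (finrank_degLT δ _).2⟩

/-- Over a division ring every nonzero left ideal of `A[t;δ]` is principal. -/
theorem exists_monic_span (hA : ∀ a : A, a ≠ 0 → IsUnit a) {J : Ideal (DiffPoly δ)}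
    (hJ : J ≠ ⊥) : ∃ h : DiffPoly δ, h.Monic ∧ J = Ideal.span {h} := by
  classical
  obtain ⟨g₀, hg₀, hne₀⟩ := Submodule.exists_mem_ne_zero_of_ne_bot hJ
  have hex : ∃ m, ∃ g ∈ J, g ≠ 0 ∧ g.natDeg = m := ⟨_, g₀, hg₀, hne₀, rfl⟩
  obtain ⟨g, hg, hne, hdeg⟩ := Nat.find_spec hex
  -- The generator is a nonzero element of least degree, made monic by a left inverse of its leading
  -- coefficient.
  have hmin : ∀ g' ∈ J, g' ∈ degLT δ (Nat.find hex) → g' = 0 := fun g' hg' hd => by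
    by_contra h0
    refine Nat.find_min' hex ⟨g', hg', h0, rfl⟩ |>.not_gt ?_
    by_contra hlt
    exact h0 (Polynomial.leadingCoeff_eq_zero.1 (mem_degLT.1 hd g'.natDeg (not_lt.1 hlt)))
  have hlc : coeff g g.natDeg ≠ 0 := fun h0 => hne (Polynomial.leadingCoeff_eq_zero.1 h0)
  obtain ⟨b, hb⟩ := (hA _ hlc).exists_left_inv
  have hm1 : coeff (C δ b * g) g.natDeg = 1 := by rw [coeff_C_mul, hb]
  have hm2 : ∀ k, g.natDeg < k → coeff (C δ b * g) k = 0 := fun k hk => by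
    rw [coeff_C_mul, mem_degLT.1 (mem_degLT_natDeg_add_one g) k hk, mul_zero]
  have hdeg' : (C δ b * g).natDeg = g.natDeg := by
    refine Polynomial.natDegree_eq_of_le_of_coeff_ne_zero (p := show A[X] from C δ b * g)
      (Polynomial.natDegree_le_iff_coeff_eq_zero.2 hm2) ?_
    intro h0
    have h1 : coeff (C δ b * g) g.natDeg = 0 := h0
    rw [hm1] at h1
    -- `Nontrivial A` is not assumed; if `1 = 0` the leading coefficient of `g` would vanish.
    exact hlc (by rw [← one_mul (coeff g _), h1, zero_mul])
  have hmon : (C δ b * g).Monic := by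
    have h : coeff (C δ b * g) (C δ b * g).natDeg = 1 := by rw [hdeg', hm1]
    exact h
  have hmem : C δ b * g ∈ J := J.mul_mem_left _ hg
  refine ⟨C δ b * g, hmon, le_antisymm (fun x hx => ?_) ((Ideal.span_singleton_le_iff_mem J).2 hmem)⟩
  rw [← modR_eq_zero_iff _ hmon]
  obtain ⟨q, hq⟩ := modR_eq _ hmon x
  refine hmin _ ?_ ?_
  · rw [eq_sub_iff_add_eq'.2 hq.symm]
    exact J.sub_mem hx (J.mul_mem_left _ hmem)
  · rw [← hdeg, ← hdeg']
    exact modR_mem _ _ _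

theorem span_ne_bot [Nontrivial A] {f : DiffPoly δ} (hf : f.Monic) : Ideal.span {f} ≠ ⊥ := by
  rw [Ne, Ideal.span_singleton_eq_bot]
  exact Polynomial.Monic.ne_zero hf

theorem natDeg_one : (1 : DiffPoly δ).natDeg = 0 := Polynomial.natDegree_one

theorem eq_one_of_natDeg_eq_zero {f : DiffPoly δ} (hf : f.Monic) (h : f.natDeg = 0) : f = 1 :=
  (Polynomial.Monic.natDegree_eq_zero (p := show A[X] from f) hf).1 h

theorem eq_of_mem_span {f h : DiffPoly δ} (hf : f.Monic) (hh : h.Monic)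
    (hd : h.natDeg = f.natDeg) (hmem : f ∈ Ideal.span {h}) : f = h := by
  refine sub_eq_zero.1 (eq_zero_of_mem_span hh
    (Ideal.sub_mem _ hmem (Ideal.mem_span_singleton_self h)) (mem_degLT.2 fun k hk => ?_))
  rw [coeff_sub]
  rcases hk.eq_or_lt with rfl | hk
  · have h1 : coeff h h.natDeg = 1 := hh
    have h2 : coeff f h.natDeg = 1 := by rw [hd]; exact hf
    rw [h1, h2, sub_self]
  · rw [mem_degLT.1 (mem_degLT_natDeg_add_one h) k hk, mem_degLT.1 (mem_degLT_natDeg_add_one f) k (by omega),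
      sub_zero]

theorem natDeg_le_of_mem_span [Nontrivial A] {f h : DiffPoly δ} (hf : f.Monic) (hh : h.Monic)
    (hmem : f ∈ Ideal.span {h}) : h.natDeg ≤ f.natDeg := by
  by_contra! hlt
  exact Polynomial.Monic.ne_zero hf (eq_zero_of_mem_span hh hmem (mem_degLT_of_natDeg_lt hlt))

theorem eq_sub_C_of_natDeg_eq_one {h : DiffPoly δ} (hh : h.Monic) (hd : h.natDeg = 1) :
    ∃ z, h = t δ - C δ z := by
  refine ⟨-coeff h 0, ?_⟩
  rw [C_neg, sub_neg_eq_add]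
  have h1 := Polynomial.eq_X_add_C_of_natDegree_le_one (p := show A[X] from h) hd.le
  have h2 : Polynomial.coeff (R := A) h 1 = 1 := by
    have : coeff h h.natDeg = 1 := hh
    rwa [hd] at this
  rw [h2, Polynomial.C_1, one_mul] at h1
  exact h1

/-- If `tᵖ - t - d` has no linear right factor, then it generates a maximal left ideal. -/
theorem isMaximal_span_t_pow_sub [Nontrivial A] [FiniteDimensional F A]
    (hA : ∀ a : A, a ≠ 0 → IsUnit a) (p : ℕ) [hp : Fact p.Prime] [CharP F p] (d : A)
    (hd : ∀ z, t δ ^ p - t δ - C δ d ∉ Ideal.span {t δ - C δ z}) :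
    (Ideal.span {t δ ^ p - t δ - C δ d}).IsMaximal := by
  have := charP_of_field δ p
  have hnt : Nontrivial (DiffPoly δ) := C_injective.nontrivial
  have hApos : 0 < Module.finrank F A := Module.finrank_pos
  set f := t δ ^ p - t δ - C δ d with hfdef
  have hf : f.Monic := monic_pow_sub δ p hp.out.one_lt d
  have hfdeg : f.natDeg = p := natDeg_t_pow_sub p hp.out.one_lt d
  have hσf : shiftEquiv δ f = f := shiftEquiv_t_pow_sub p d
  have hftop : Ideal.span {f} ≠ ⊤ := fun h => by
    have h1 : (1 : DiffPoly δ) ∈ Ideal.span {f} := h ▸ Submodule.mem_top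
    exact one_ne_zero (eq_zero_of_mem_span hf h1
      (mem_degLT_of_natDeg_lt (by rw [natDeg_one, hfdeg]; exact hp.out.pos)))
  obtain ⟨J, hJmax, hfJ⟩ := Ideal.exists_le_maximal _ hftop
  obtain ⟨h, hh, rfl⟩ := exists_monic_span hA (ne_bot_of_le_ne_bot (span_ne_bot hf) hfJ)
  have hfh : f ∈ Ideal.span {h} := hfJ (Ideal.mem_span_singleton_self f)
  have hfin := (finrank_quotient_span (F := F) hh).1
  -- The conjugates of the maximal left ideal under the powers of `σ`.
  let I : ℕ → Ideal (DiffPoly δ) := fun i => (Ideal.span {h}).comap (shiftEquiv δ ^ i)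
  have hI : ∀ i g, g ∈ I i ↔ (shiftEquiv δ ^ i) g ∈ Ideal.span {h} := fun i g => Iff.rfl
  let N := (Finset.range p).inf I
  -- Because `σᵖ = 1`, the `p` conjugates already account for all exponents, which makes `N` stable
  -- under `σ`.
  have hN : ∀ g, g ∈ N ↔ ∀ i, (shiftEquiv δ ^ i) g ∈ Ideal.span {h} := fun g => by
    rw [Submodule.mem_finsetInf]
    refine ⟨fun hg i => ?_, fun hg i _ => hg i⟩
    rw [pow_eq_pow_mod i (shiftEquiv_pow_char (δ := δ) p)]
    exact hg _ (Finset.mem_range.2 (Nat.mod_lt _ hp.out.pos))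
  have hfN : f ∈ N := (hN f).2 fun i => by
    have : (shiftEquiv δ ^ i) f = f := by
      induction i with
      | zero => rfl
      | succ i ih => rw [pow_succ', AlgEquiv.mul_apply, ih, hσf]
    rwa [this]
  have hdvd := (dvd_finrank_quotient_iInf (F := F) (Finset.range p) I
    (Module.finrank F (DiffPoly δ ⧸ Ideal.span {h}))
    (fun i => Ideal.comap_isMaximal_of_equiv (shiftEquiv δ ^ i))
    (fun i => (quotient_comap (shiftEquiv δ ^ i) _).1)
    (fun i => (quotient_comap (shiftEquiv δ ^ i) _).2)).2
  obtain ⟨u, hu, hNu⟩ := exists_monic_span hA (J := N)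
    (fun h0 => Polynomial.Monic.ne_zero hf ((Submodule.eq_bot_iff N).1 h0 f hfN))
  have huN : u ∈ N := hNu ▸ Ideal.mem_span_singleton_self u
  -- `σ u` and `u` lie in `N = Ru` and share their leading term, so their difference is a multiple
  -- of `u` of smaller degree, hence zero.
  have hσu : shiftEquiv δ u = u := by
    refine sub_eq_zero.1 (eq_zero_of_mem_span hu ?_ (mem_degLT.2 fun k hk => ?_))
    · rw [← hNu]
      refine N.sub_mem ((hN _).2 fun i => ?_) huN
      have := (hN u).1 huN (i + 1)
      rwa [pow_succ, AlgEquiv.mul_apply] at this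
    · rw [coeff_sub]
      rw [coeff_shiftEquiv (mem_degLT_of_natDeg_lt (Nat.lt_succ_of_le hk)), sub_self]
  have hup : p ∣ u.natDeg := by
    have : CharP A p := charP_of_injective_algebraMap (algebraMap F A).injective p
    exact (CharP.cast_eq_zero_iff A p _).1 (natDeg_cast_eq_zero hu hσu)
  have hule : u.natDeg ≤ p := hfdeg ▸ natDeg_le_of_mem_span hf hu (hNu ▸ hfN)
  have hu0 : u.natDeg ≠ 0 := fun h0 => hJmax.ne_top <| by
    have h1 := (hN u).1 huN 0
    rw [eq_one_of_natDeg_eq_zero hu h0, map_one] at h1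
    exact (Ideal.eq_top_iff_one _).2 h1
  have huq : u.natDeg = p :=
    le_antisymm hule (Nat.le_of_dvd (Nat.pos_of_ne_zero hu0) hup)
  change _ ∣ Module.finrank F (DiffPoly δ ⧸ N) at hdvd
  rw [hNu, (finrank_quotient_span hh).2, (finrank_quotient_span hu).2, huq] at hdvd
  -- The codimensions are `deg h · [A:F]` and `p · [A:F]`, so `deg h` is `1` or `p`.
  rcases (Nat.dvd_prime hp.out).1 (Nat.dvd_of_mul_dvd_mul_right hApos hdvd) with h1 | h1
  · obtain ⟨z, rfl⟩ := eq_sub_C_of_natDeg_eq_one hh h1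
    exact absurd hfh (hd z)
  · rwa [eq_of_mem_span hf hh (h1.trans hfdeg.symm) hfh]

/-- If `f` generates a maximal left ideal, then its Petit algebra has no zero divisors. -/
theorem eq_zero_of_mul_mem_span [Nontrivial A] [FiniteDimensional F A]
    (hA : ∀ a : A, a ≠ 0 → IsUnit a) {f : DiffPoly δ} (hf : f.Monic)
    (hmax : (Ideal.span {f}).IsMaximal) {g h : DiffPoly δ} (hg : g ∈ degLT δ f.natDeg)
    (hh : h ∈ degLT δ f.natDeg) (h0 : h ≠ 0) (hgh : g * h ∈ Ideal.span {f}) : g = 0 := by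
  have hnt : Nontrivial (DiffPoly δ) := C_injective.nontrivial
  have hApos : 0 < Module.finrank F A := Module.finrank_pos
  -- Right multiplication by `h` modulo `f`. It is onto by maximality, so its kernel has the
  -- codimension of `Rf` and a generator of degree `deg f`; `g` lies in it with smaller degree.
  let ρ : DiffPoly δ →ₗ[DiffPoly δ] DiffPoly δ ⧸ Ideal.span {f} :=
    (Submodule.mkQ _) ∘ₗ LinearMap.toSpanSingleton _ _ h
  have hρ : ∀ x, x ∈ LinearMap.ker ρ ↔ x * h ∈ Ideal.span {f} := fun x =>
    LinearMap.mem_ker.trans (Submodule.Quotient.mk_eq_zero _)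
  have hsurj : Function.Surjective ρ := by
    intro y
    obtain ⟨y, rfl⟩ := Submodule.mkQ_surjective _ y
    have hlt : h ∉ Ideal.span {f} := fun h1 => h0 (eq_zero_of_mem_span hf h1 hh)
    have hsup : Ideal.span {f} ⊔ Ideal.span {h} = ⊤ := hmax.1.2 _ (left_lt_sup.2 fun hle =>
      hlt (hle (Ideal.mem_span_singleton_self h)))
    obtain ⟨i, hi, j, hj, rfl⟩ := Submodule.mem_sup.1
      (hsup ▸ Submodule.mem_top : y ∈ Ideal.span {f} ⊔ Ideal.span {h})
    obtain ⟨x, rfl⟩ := Ideal.mem_span_singleton'.1 hj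
    refine ⟨x, ?_⟩
    have hi' : Submodule.mkQ (Ideal.span {f}) i = 0 := (Submodule.Quotient.mk_eq_zero _).2 hi
    rw [map_add, hi', zero_add]
    rfl
  have e := (ρ.quotKerEquivOfSurjective hsurj).restrictScalars F
  have hfr := e.finrank_eq
  have hfin := (finrank_quotient_span (F := F) hf).1
  have hkfin : Module.Finite F (DiffPoly δ ⧸ LinearMap.ker ρ) := Module.Finite.equiv e.symm
  by_contra hg0
  obtain ⟨u, hu, hku⟩ := exists_monic_span hA (J := LinearMap.ker ρ)
    (fun hb => hg0 ((Submodule.eq_bot_iff _).1 hb g ((hρ g).2 hgh)))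
  rw [hku, (finrank_quotient_span hf).2, (finrank_quotient_span hu).2] at hfr
  have hdeg := Nat.eq_of_mul_eq_mul_right hApos hfr
  exact hg0 (eq_zero_of_mem_span hu (hku ▸ (hρ g).2 hgh) (hdeg ▸ hg))

end Ideals

end DiffPoly

/-! ### The division criterion. -/

namespace PetitAlgebra

variable {F A : Type*} [Field F] [Ring A] [Algebra F A] {δ : NCDerivation F A}

theorem mk_eq_zero_iff (f : DiffPoly δ) (hf : f.Monic) (g : DiffPoly δ) :
    mk f hf g = 0 ↔ g ∈ Ideal.span {f} := by
  rw [← DiffPoly.modR_eq_zero_iff f hf]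
  exact Subtype.ext_iff

theorem rep_mk_of_mem {f : DiffPoly δ} {hf : f.Monic} {g : DiffPoly δ}
    (hg : g ∈ DiffPoly.degLT δ f.natDeg) : (mk f hf g).rep = g :=
  DiffPoly.modR_of_mem f hf g hg

theorem finite_finrank [FiniteDimensional F A] (f : DiffPoly δ) (hf : f.Monic) :
    Module.Finite F (PetitAlgebra f hf) ∧
      Module.finrank F (PetitAlgebra f hf) = f.natDeg * Module.finrank F A :=
  DiffPoly.finrank_degLT δ f.natDeg

end PetitAlgebra

/-- A finite-dimensional algebra without zero divisors is a division algebra. -/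
theorem isDivisionAlgebra_of_noZeroDivisors {F B : Type*} [Field F] [NonUnitalNonAssocRing B]
    [Module F B] [IsScalarTower F B B] [SMulCommClass F B B] [FiniteDimensional F B]
    [Nontrivial B] (h : ∀ x y : B, x * y = 0 → x = 0 ∨ y = 0) : IsDivisionAlgebra B := by
  refine ⟨inferInstance, fun a ha => ⟨?_, ?_⟩⟩
  · have hinj : Function.Injective (LinearMap.mulLeft F a) :=
      (injective_iff_map_eq_zero _).2 fun x hx => (h a x hx).resolve_left ha
    exact ⟨hinj, LinearMap.injective_iff_surjective.1 hinj⟩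
  · have hinj : Function.Injective (LinearMap.mulRight F a) :=
      (injective_iff_map_eq_zero _).2 fun x hx => (h x a hx).resolve_right ha
    exact ⟨hinj, LinearMap.injective_iff_surjective.1 hinj⟩

theorem IsDivisionAlgebra.isUnit {A : Type*} [Ring A] (h : IsDivisionAlgebra A) (a : A)
    (ha : a ≠ 0) : IsUnit a := by
  obtain ⟨b, hb⟩ := (h.2 a ha).1.2 1
  obtain ⟨c, hc⟩ := (h.2 a ha).2.2 1
  exact isUnit_iff_exists.2 ⟨b, hb, by rwa [left_inv_eq_right_inv hc hb] at hc⟩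

theorem IsDivisionAlgebra.of_equiv {F A B : Type*} [Field F] [NonUnitalNonAssocRing A]
    [Module F A] [NonUnitalNonAssocRing B] [Module F B] (φ : A ≃ₗ[F] B)
    (hφ : ∀ x y, φ (x * y) = φ x * φ y) (h : IsDivisionAlgebra A) : IsDivisionAlgebra B := by
  have := h.1
  refine ⟨φ.injective.nontrivial, fun b hb => ?_⟩
  obtain ⟨h1, h2⟩ := h.2 (φ.symm b) (by simpa using hb)
  constructor
  · convert φ.bijective.comp (h1.comp φ.symm.bijective) using 1
    ext x
    simp [hφ]
  · convert φ.bijective.comp (h2.comp φ.symm.bijective) using 1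
    ext x
    simp [hφ]

/-- The criterion for `(A, δ, d)` to be a division algebra. -/
theorem DiffExt.isDivisionAlgebra_iff {F A : Type*} [Field F] [Ring A] [Algebra F A]
    [Nontrivial A] [FiniteDimensional F A] (hA : ∀ a : A, a ≠ 0 → IsUnit a)
    (δ : NCDerivation F A) (p : ℕ) [hp : Fact p.Prime] [CharP F p] (d : A) :
    IsDivisionAlgebra (DiffExt δ p d) ↔ ∀ z, d ≠ DiffPoly.V δ p z - z := by
  have hnt : Nontrivial (DiffPoly δ) := DiffPoly.C_injective.nontrivial
  have hf := DiffPoly.monic_pow_sub δ p hp.out.one_lt d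
  have hdeg := DiffPoly.natDeg_t_pow_sub (δ := δ) p hp.out.one_lt d
  simp only [Ne, ← DiffPoly.t_pow_sub_mem_span_iff]
  constructor
  · rintro ⟨-, h⟩ z hz
    set f := DiffPoly.t δ ^ p - DiffPoly.t δ - DiffPoly.C δ d
    have hmem : DiffPoly.t δ - DiffPoly.C δ z ∈ DiffPoly.degLT δ f.natDeg :=
      DiffPoly.mem_degLT_of_natDeg_lt (by rw [DiffPoly.natDeg_sub_C, hdeg]; exact hp.out.one_lt)
    have hu := PetitAlgebra.rep_mk_of_mem (hf := hf) hmem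
    have hu0 : PetitAlgebra.mk f hf (DiffPoly.t δ - DiffPoly.C δ z) ≠ 0 := fun h0 =>
      Polynomial.Monic.ne_zero (DiffPoly.monic_sub_C (δ := δ) z)
        (DiffPoly.eq_zero_of_mem_span hf ((PetitAlgebra.mk_eq_zero_iff f hf _).1 h0) hmem)
    obtain ⟨v, hv⟩ := (h _ hu0).2.2 (PetitAlgebra.mk f hf 1)
    have hv' : DiffPoly.modR f hf (v.rep * (DiffPoly.t δ - DiffPoly.C δ z)) =
        DiffPoly.modR f hf 1 := by
      rw [← hu]
      exact congrArg PetitAlgebra.rep hv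
    obtain ⟨q, hq⟩ := DiffPoly.modR_eq f hf (v.rep * (DiffPoly.t δ - DiffPoly.C δ z))
    obtain ⟨q', hq'⟩ := DiffPoly.modR_eq f hf 1
    rw [hv'] at hq
    -- `v (t - z)` and `1` agree modulo `f`, and `f` is itself a left multiple of `t - z`.
    have h1 : (1 : DiffPoly δ) ∈ Ideal.span {DiffPoly.t δ - DiffPoly.C δ z} := by
      rw [hq', ← sub_eq_iff_eq_add'.2 hq]
      exact Ideal.add_mem _ (Ideal.mul_mem_left _ _ hz) (Ideal.sub_mem _
        (Ideal.mul_mem_left _ _ (Ideal.mem_span_singleton_self _)) (Ideal.mul_mem_left _ _ hz))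
    exact one_ne_zero (DiffPoly.eq_zero_of_mem_span (DiffPoly.monic_sub_C z) h1
      (DiffPoly.mem_degLT_of_natDeg_lt (by
        rw [DiffPoly.natDeg_sub_C, DiffPoly.natDeg_one]; exact one_pos)))
  · intro hd
    have hmax := DiffPoly.isMaximal_span_t_pow_sub hA p d hd
    have hfin := (PetitAlgebra.finite_finrank _ hf).1
    have hfr := (PetitAlgebra.finite_finrank (F := F) _ hf).2
    have hnt : Nontrivial (DiffExt δ p d) := Module.nontrivial_of_finrank_pos (R := F) (by
      rw [hfr, hdeg]; exact Nat.mul_pos hp.out.pos Module.finrank_pos)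
    refine isDivisionAlgebra_of_noZeroDivisors (F := F) fun x y hxy => ?_
    by_cases hy : y.rep = 0
    · exact Or.inr (Subtype.ext hy)
    · exact Or.inl (Subtype.ext (DiffPoly.eq_zero_of_mul_mem_span hA hf hmax x.2 y.2 hy
        ((PetitAlgebra.mk_eq_zero_iff _ hf _).1 hxy)))

/-! ### The degree of `E/F`. -/

open Polynomial in
-- Distinct linear factors are coprime, so the kernel is the sum of the eigenspaces, each at most a
-- line.
theorem finrank_ker_aeval_prod_le {F V : Type*} [Field F] [AddCommGroup V] [Module F V]
    [FiniteDimensional F V] (f : Module.End F V) (hf : ∀ c : F, Module.finrank F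
      (LinearMap.ker (f - algebraMap F (Module.End F V) c)) ≤ 1) (s : Finset F) :
    Module.finrank F (LinearMap.ker (aeval f (∏ c ∈ s, (X - C c)))) ≤ s.card := by
  classical
  induction s using Finset.induction_on with
  | empty =>
    rw [Finset.prod_empty, map_one]
    rw [Module.End.one_eq_id, LinearMap.ker_id, finrank_bot, Finset.card_empty]
  | insert a s ha ih =>
    have hcop : IsCoprime (X - C a) (∏ c ∈ s, (X - C c)) :=
      IsCoprime.prod_right fun c hc => isCoprime_X_sub_C_of_isUnit_sub
        (sub_ne_zero.2 (ne_of_mem_of_not_mem hc ha).symm).isUnit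
    rw [Finset.prod_insert ha, Finset.card_insert_of_notMem ha,
      ← sup_ker_aeval_eq_ker_aeval_mul_of_coprime f hcop]
    refine (Submodule.finrank_add_le_finrank_add_finrank _ _).trans ?_
    rw [add_comm]
    refine add_le_add ih ?_
    rw [map_sub, aeval_X, aeval_C]
    exact hf a

namespace Derivation

variable {F E : Type*} [Field F] [Field E] [Algebra F E]

/-- The eigenspaces of a derivation with field of constants `F` are at most one-dimensional. -/
theorem finrank_ker_sub_algebraMap_le_one (δ : Derivation F E E)
    (hconst : ∀ a : E, δ a = 0 ↔ a ∈ (algebraMap F E).range) (c : F) :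
    Module.finrank F
      (LinearMap.ker ((δ.toLinearMap : Module.End F E) - algebraMap F (Module.End F E) c)) ≤ 1 := by
  have hmem : ∀ x : LinearMap.ker
      ((δ.toLinearMap : Module.End F E) - algebraMap F (Module.End F E) c),
      δ (x : E) = c • (x : E) := fun x => sub_eq_zero.1 (LinearMap.mem_ker.1 x.2)
  by_cases h : ∃ y : LinearMap.ker
      ((δ.toLinearMap : Module.End F E) - algebraMap F (Module.End F E) c), (y : E) ≠ 0
  · obtain ⟨y, hy⟩ := h
    refine finrank_le_one y fun x => ?_
    -- The quotient of two eigenvectors with the same eigenvalue is a constant, hence lies in `F`.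
    have h0 : δ ((x : E) / y) = 0 := by
      rw [div_eq_mul_inv, δ.leibniz, δ.leibniz_inv, hmem, hmem]
      simp only [smul_eq_mul, Algebra.smul_def]
      field_simp
      ring
    obtain ⟨k, hk⟩ := (hconst _).1 h0
    refine ⟨k, Subtype.ext ?_⟩
    rw [Submodule.coe_smul, Algebra.smul_def, hk, div_mul_cancel₀ _ hy]
  · push Not at h
    have : Subsingleton (LinearMap.ker
      ((δ.toLinearMap : Module.End F E) - algebraMap F (Module.End F E) c)) :=
      ⟨fun x y => Subtype.ext ((h x).trans (h y).symm)⟩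
    rw [Module.finrank_zero_of_subsingleton]
    exact zero_le_one

open Polynomial in
/-- A derivation with field of constants `F` and minimal polynomial `tᵖ - t` lives on an extension
of degree `p`. -/
theorem finrank_eq_of_minpoly [FiniteDimensional F E] (p : ℕ) [hp : Fact p.Prime] [CharP F p] (δ : Derivation F E E)
    (hconst : ∀ a : E, δ a = 0 ↔ a ∈ (algebraMap F E).range)
    (hmin : minpoly F (δ.toLinearMap : Module.End F E) = (X ^ p - X : F[X])) :
    Module.finrank F E = p := by
  classical
  have hdeg : (X ^ p - X : F[X]).natDegree = p :=
    FiniteField.X_pow_card_sub_X_natDegree_eq F hp.out.one_lt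
  apply le_antisymm
  -- `Xᵖ - X` splits over the prime field with simple roots; the factorization is pushed into `F`.
  · let ι : ZMod p →+* F := ZMod.castHom dvd_rfl F
    have hprod : (X ^ p - X : F[X]) = ∏ c ∈ Finset.univ.map ⟨ι, ι.injective⟩, (X - C c) := by
      have hZ : (X ^ p - X : (ZMod p)[X]).natDegree = p :=
        FiniteField.X_pow_card_sub_X_natDegree_eq _ hp.out.one_lt
      have hroots : (X ^ p - X : (ZMod p)[X]).roots = Finset.univ.val := by
        have h := FiniteField.roots_X_pow_card_sub_X (ZMod p)
        rwa [ZMod.card] at h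
      have h := prod_multiset_X_sub_C_of_monic_of_roots_card_eq (p := (X ^ p - X : (ZMod p)[X]))
        (monic_X_pow_sub (by rw [degree_X]; exact_mod_cast hp.out.one_lt))
        (by rw [hZ, hroots]; exact (Finset.card_univ).trans (ZMod.card p))
      rw [hroots] at h
      replace h : ∏ c : ZMod p, (X - C c) = X ^ p - X := h
      have h' := congrArg (Polynomial.map ι) h
      rw [Polynomial.map_prod] at h'
      simpa [Finset.prod_map] using h'.symm
    have hker : LinearMap.ker (aeval (δ.toLinearMap : Module.End F E) (X ^ p - X : F[X])) = ⊤ := by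
      rw [← hmin, minpoly.aeval, LinearMap.ker_zero]
    have h := finrank_ker_aeval_prod_le (δ.toLinearMap : Module.End F E)
      (finrank_ker_sub_algebraMap_le_one δ hconst) (Finset.univ.map ⟨ι, ι.injective⟩)
    rwa [← hprod, hker, finrank_top, Finset.card_map, Finset.card_univ, ZMod.card] at h
  -- Cayley–Hamilton gives the other inequality.
  · have h := natDegree_le_of_dvd (LinearMap.minpoly_dvd_charpoly
      (δ.toLinearMap : Module.End F E)) (LinearMap.charpoly_monic _).ne_zero
    rwa [hmin, hdeg, LinearMap.charpoly_natDegree] at h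

end Derivation

theorem Derivation.extendNC_tmul {F E D : Type*} [CommRing F] [CommRing E] [Algebra F E] [Ring D]
    [Algebra F D] (δ : Derivation F E E) (b : D) (a : E) :
    (δ.extendNC D).toLinearMap (b ⊗ₜ[F] a) = b ⊗ₜ[F] δ a := rfl

/-! ### Maps induced on Petit algebras. -/

namespace PetitAlgebra

variable {F A : Type*} [CommRing F] [Ring A] [Algebra F A] {δ : NCDerivation F A}

/-- Representatives as a linear map. -/
def repHom (f : DiffPoly δ) (hf : f.Monic) : PetitAlgebra f hf →ₗ[F] DiffPoly δ :=
  (DiffPoly.degLT δ f.natDeg).subtype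

/-- The class map as a linear map. -/
def mkHom (f : DiffPoly δ) (hf : f.Monic) : DiffPoly δ →ₗ[F] PetitAlgebra f hf where
  toFun := mk f hf
  map_add' g h := Subtype.ext (DiffPoly.modR_add f hf g h)
  map_smul' c g := Subtype.ext (DiffPoly.modR_smul f hf c g)

theorem mk_rep {f : DiffPoly δ} {hf : f.Monic} (x : PetitAlgebra f hf) : mk f hf x.rep = x :=
  ext_rep f hf (modR_rep f hf x)

theorem mk_mul_mk {f : DiffPoly δ} {hf : f.Monic} {g h : DiffPoly δ}
    (hg : g ∈ DiffPoly.degLT δ f.natDeg) (hh : h ∈ DiffPoly.degLT δ f.natDeg) :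
    mk f hf g * mk f hf h = mk f hf (g * h) := by
  have h1 : (mk f hf g).rep = g := DiffPoly.modR_of_mem f hf g hg
  have h2 : (mk f hf h).rep = h := DiffPoly.modR_of_mem f hf h hh
  refine ext_rep f hf ?_
  rw [rep_mul, h1, h2]
  rfl

theorem mk_eq_mk {f : DiffPoly δ} {hf : f.Monic} {g h : DiffPoly δ}
    (q : DiffPoly δ) (hq : g = q * f + h) : mk f hf g = mk f hf h := by
  refine ext_rep f hf ?_
  obtain ⟨q', hq'⟩ := DiffPoly.modR_eq f hf h
  exact DiffPoly.modR_unique f hf _ _ (q + q') (DiffPoly.modR_mem f hf h) (by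
    rw [add_mul, add_assoc, hq]
    exact congrArg (q * f + ·) hq')

/-- An automorphism of `A[t;δ]` which fixes `f` and does not raise degrees acts on the Petit
algebra of `f`. -/
def mapEquiv (f : DiffPoly δ) (hf : f.Monic) (σ : DiffPoly δ ≃ₐ[F] DiffPoly δ)
    (h : ∀ g ∈ DiffPoly.degLT δ f.natDeg, σ g ∈ DiffPoly.degLT δ f.natDeg)
    (h' : ∀ g ∈ DiffPoly.degLT δ f.natDeg, σ.symm g ∈ DiffPoly.degLT δ f.natDeg) :
    PetitAlgebra f hf ≃ₗ[F] PetitAlgebra f hf where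
  toFun x := ⟨σ x.rep, h _ x.2⟩
  invFun x := ⟨σ.symm x.rep, h' _ x.2⟩
  map_add' x y := Subtype.ext (map_add σ x.rep y.rep)
  map_smul' c x := Subtype.ext (map_smul σ c x.rep)
  left_inv x := Subtype.ext (σ.symm_apply_apply x.rep)
  right_inv x := Subtype.ext (σ.apply_symm_apply x.rep)

theorem rep_mapEquiv (f : DiffPoly δ) (hf : f.Monic) (σ : DiffPoly δ ≃ₐ[F] DiffPoly δ)
    (h : ∀ g ∈ DiffPoly.degLT δ f.natDeg, σ g ∈ DiffPoly.degLT δ f.natDeg)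
    (h' : ∀ g ∈ DiffPoly.degLT δ f.natDeg, σ.symm g ∈ DiffPoly.degLT δ f.natDeg)
    (x : PetitAlgebra f hf) : (mapEquiv f hf σ h h' x).rep = σ x.rep := rfl

/-- Applying `σ` to `g h = q f + r` gives `σ(g) σ(h) = σ(q) f + σ(r)`, and `σ(r)` is still short
enough to be the remainder. -/
theorem mapEquiv_mul (f : DiffPoly δ) (hf : f.Monic) (σ : DiffPoly δ ≃ₐ[F] DiffPoly δ)
    (h : ∀ g ∈ DiffPoly.degLT δ f.natDeg, σ g ∈ DiffPoly.degLT δ f.natDeg)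
    (h' : ∀ g ∈ DiffPoly.degLT δ f.natDeg, σ.symm g ∈ DiffPoly.degLT δ f.natDeg)
    (hσ : σ f = f) (x y : PetitAlgebra f hf) :
    mapEquiv f hf σ h h' (x * y) = mapEquiv f hf σ h h' x * mapEquiv f hf σ h h' y := by
  refine ext_rep f hf ?_
  rw [rep_mul, rep_mapEquiv, rep_mapEquiv, rep_mapEquiv, ← map_mul, rep_mul]
  obtain ⟨q, hq⟩ := DiffPoly.modR_eq f hf (x.rep * y.rep)
  refine (DiffPoly.modR_unique f hf _ _ (σ q) (h _ (DiffPoly.modR_mem f hf _)) ?_).symm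
  conv_lhs => rw [hq, map_add, map_mul, hσ]

end PetitAlgebra

theorem DiffExt.mem_degLT_iff {F A : Type*} [CommRing F] [Ring A] [Algebra F A] [Nontrivial A]
    {δ : NCDerivation F A} (p : ℕ) [hp : Fact p.Prime] {d : A} {g : DiffPoly δ} :
    g ∈ DiffPoly.degLT δ (DiffPoly.t δ ^ p - DiffPoly.t δ - DiffPoly.C δ d).natDeg ↔
      g ∈ DiffPoly.degLT δ p := by
  rw [DiffPoly.natDeg_t_pow_sub p hp.out.one_lt]

/-! ### The automorphism of order `p` on `(A, δ, d)`. -/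

section Shift

open DiffPoly

variable {F A : Type*} [Field F] [Ring A] [Algebra F A] [FiniteDimensional F A]

/-- An injective endomorphism of a finite-dimensional space is onto, so the bound for `σ` passes to
its inverse. -/
theorem shiftEquiv_symm_mem_degLT (δ : NCDerivation F A) {f : DiffPoly δ} {m : ℕ}
    (hf : f ∈ degLT δ m) : (shiftEquiv δ).symm f ∈ degLT δ m := by
  have := (finrank_degLT δ m).1
  let L : degLT δ m →ₗ[F] degLT δ m :=
    (shiftEquiv δ).toLinearMap.restrict fun _ => shiftEquiv_mem_degLT
  have hinj : Function.Injective L := fun x y h =>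
    Subtype.ext ((shiftEquiv δ).injective (congrArg Subtype.val h))
  obtain ⟨x, hx⟩ := LinearMap.injective_iff_surjective.1 hinj ⟨f, hf⟩
  have hx' : shiftEquiv δ x.1 = f := congrArg Subtype.val hx
  rw [← hx', AlgEquiv.symm_apply_apply]
  exact x.2

variable (δ : NCDerivation F A) (p : ℕ) [hp : Fact p.Prime] (d : A)

/-- The automorphism `G_{id,-1}` of `(A, δ, d)`. -/
def DiffExt.shift : DiffExt δ p d ≃ₗ[F] DiffExt δ p d :=
  PetitAlgebra.mapEquiv _ _ (shiftEquiv δ) (fun _ => shiftEquiv_mem_degLT)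
    fun _ => shiftEquiv_symm_mem_degLT δ

theorem DiffExt.rep_shift (x : DiffExt δ p d) :
    (DiffExt.shift δ p d x).rep = shiftEquiv δ x.rep := rfl

variable [Nontrivial A] [CharP F p]

theorem DiffExt.shift_mul (x y : DiffExt δ p d) :
    DiffExt.shift δ p d (x * y) = DiffExt.shift δ p d x * DiffExt.shift δ p d y := by
  have := charP_of_field δ p
  exact PetitAlgebra.mapEquiv_mul _ _ _ _ _ (shiftEquiv_t_pow_sub p d) x y

theorem DiffExt.orderOf_shift : orderOf (DiffExt.shift δ p d) = p := by
  have := charP_of_field δ p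
  have hnt : Nontrivial (DiffPoly δ) := C_injective.nontrivial
  have hpow : ∀ (n : ℕ) (x : DiffExt δ p d),
      ((DiffExt.shift δ p d ^ n) x).rep = (shiftEquiv δ ^ n) x.rep := fun n x => by
    induction n with
    | zero => rfl
    | succ n ih =>
      rw [pow_succ', pow_succ', LinearEquiv.mul_apply, AlgEquiv.mul_apply, ← ih, rep_shift]
  refine orderOf_eq_prime ?_ fun h => ?_
  · ext x
    refine Subtype.ext ((hpow p x).trans ?_)
    rw [shiftEquiv_pow_char]
    rfl
  -- Since `p > 1`, the class of `t` has representative `t`, and it is moved to `t - 1`.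
  · have hmem : t δ ∈ degLT δ (t δ ^ p - t δ - C δ d).natDeg :=
      (DiffExt.mem_degLT_iff p).2 <| mem_degLT.2 fun k hk => by
        rw [← pow_one (t δ), coeff_t_pow, if_neg (by have := hp.out.one_lt; omega)]
    have h1 := rep_shift δ p d (PetitAlgebra.mk _ _ (t δ))
    rw [h, LinearEquiv.coe_one, id_eq, PetitAlgebra.rep_mk_of_mem hmem, shiftEquiv_t] at h1
    exact one_ne_zero (sub_eq_self.1 h1.symm)

end Shift

/-! ### The isomorphism `(E, δ, d) ⊗ D ≃ (D_E, δ, d)`. -/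

section TensorIso

open DiffPoly

variable {F E : Type*} (D : Type*) [Field F] [Field E] [Algebra F E] [Ring D] [Algebra F D]
  (δ : Derivation F E E)

/-- The inclusion `E[t;δ] → D_E[t;δ]`. -/
def DiffPoly.inclHom : DiffPoly δ.toNC →ₐ[F] DiffPoly (δ.extendNC D) :=
  liftHom δ.toNC ((CHom (δ.extendNC D)).comp Algebra.TensorProduct.includeRight)
    (t (δ.extendNC D)) fun a => t_mul_C (δ.extendNC D) ((1 : D) ⊗ₜ[F] a)

variable {D δ}

theorem DiffPoly.inclHom_C (a : E) :
    inclHom D δ (C δ.toNC a) = C (δ.extendNC D) ((1 : D) ⊗ₜ[F] a) := liftHom_C _ _ _ a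

theorem DiffPoly.inclHom_t : inclHom D δ (t δ.toNC) = t (δ.extendNC D) := liftHom_t _ _ _

theorem DiffPoly.coeff_inclHom (f : DiffPoly δ.toNC) (n : ℕ) :
    coeff (inclHom D δ f) n = (1 : D) ⊗ₜ[F] coeff f n := by
  induction f using DiffPoly.induction_on with
  | hadd f g hf hg => rw [map_add, coeff_add, hf, hg, coeff_add, TensorProduct.tmul_add]
  | hmon i a =>
    rw [map_mul, map_pow, inclHom_C, inclHom_t, coeff_C_mul, coeff_C_mul, coeff_t_pow, coeff_t_pow]
    split_ifs <;> simp

/-- `b ⊗ 1` commutes with `1 ⊗ a` in the tensor product, and with `t` because the extended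
derivation kills `D`. -/
theorem DiffPoly.commute_inclHom (f : DiffPoly δ.toNC) (b : D) :
    Commute (inclHom D δ f)
      (((CHom (δ.extendNC D)).comp Algebra.TensorProduct.includeLeft : D →ₐ[F] _) b) := by
  change Commute (inclHom D δ f) (C (δ.extendNC D) (b ⊗ₜ[F] (1 : E)))
  induction f using DiffPoly.induction_on with
  | hadd f g hf hg => rw [map_add]; exact hf.add_left hg
  | hmon i a =>
    rw [map_mul, map_pow, inclHom_C, inclHom_t]
    refine Commute.mul_left ?_ (Commute.pow_left ?_ i)
    · change _ * _ = _ * _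
      rw [C_mul_C, C_mul_C]
      simp
    · change _ * _ = _ * _
      rw [t_mul_C, Derivation.extendNC_tmul, δ.map_one_eq_zero, TensorProduct.tmul_zero, C_zero,
        add_zero]

variable (D δ)

/-- The homomorphism `E[t;δ] ⊗ D → D_E[t;δ]`. -/
def DiffPoly.tensorHom : DiffPoly δ.toNC ⊗[F] D →ₐ[F] DiffPoly (δ.extendNC D) :=
  Algebra.TensorProduct.lift (inclHom D δ)
    ((CHom (δ.extendNC D)).comp Algebra.TensorProduct.includeLeft) commute_inclHom

theorem DiffPoly.tensorHom_tmul (f : DiffPoly δ.toNC) (b : D) :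
    tensorHom D δ (f ⊗ₜ[F] b) = inclHom D δ f * C (δ.extendNC D) (b ⊗ₜ[F] (1 : E)) :=
  Algebra.TensorProduct.lift_tmul _ _ _ f b

theorem DiffPoly.tensorHom_tmul' (f : DiffPoly δ.toNC) (b : D) :
    tensorHom D δ (f ⊗ₜ[F] b) = C (δ.extendNC D) (b ⊗ₜ[F] (1 : E)) * inclHom D δ f :=
  (tensorHom_tmul D δ f b).trans (commute_inclHom f b)

theorem DiffPoly.tensorHom_mem_degLT {f : DiffPoly δ.toNC} {m : ℕ} (hf : f ∈ degLT δ.toNC m)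
    (b : D) : tensorHom D δ (f ⊗ₜ[F] b) ∈ degLT (δ.extendNC D) m := by
  refine mem_degLT.2 fun k hk => ?_
  rw [tensorHom_tmul', coeff_C_mul, coeff_inclHom, mem_degLT.1 hf k hk, TensorProduct.tmul_zero,
    mul_zero]

theorem DiffPoly.tensorHom_monomial (a : E) (i : ℕ) (b : D) :
    tensorHom D δ ((C δ.toNC a * t δ.toNC ^ i) ⊗ₜ[F] b) =
      C (δ.extendNC D) (b ⊗ₜ[F] a) * t (δ.extendNC D) ^ i := by
  rw [tensorHom_tmul', map_mul, map_pow, inclHom_C, inclHom_t, ← mul_assoc, C_mul_C,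
    Algebra.TensorProduct.tmul_mul_tmul, mul_one, one_mul]

variable (p : ℕ) [hp : Fact p.Prime] (d : E)

/-- The map `(E, δ, d) ⊗ D → (D_E, δ, d)`. -/
def DiffExt.tensorMap :
    DiffExt δ.toNC p d ⊗[F] D →ₗ[F] DiffExt (δ.extendNC D) p ((1 : D) ⊗ₜ[F] d) :=
  PetitAlgebra.mkHom _ _ ∘ₗ (tensorHom D δ).toLinearMap ∘ₗ (PetitAlgebra.repHom _ _).rTensor D

theorem DiffExt.tensorMap_tmul (x : DiffExt δ.toNC p d) (b : D) :
    tensorMap D δ p d (x ⊗ₜ[F] b) = PetitAlgebra.mk _ _ (tensorHom D δ (x.rep ⊗ₜ[F] b)) := rfl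

theorem DiffExt.tensorMap_monomial (a : E) (i : ℕ) (b : D) (hi : i < p) :
    tensorMap D δ p d (PetitAlgebra.mk _ _ (C δ.toNC a * t δ.toNC ^ i) ⊗ₜ[F] b) =
      PetitAlgebra.mk _ _ (C (δ.extendNC D) (b ⊗ₜ[F] a) * t (δ.extendNC D) ^ i) := by
  rw [tensorMap_tmul, PetitAlgebra.rep_mk_of_mem, tensorHom_monomial]
  refine (DiffExt.mem_degLT_iff p).2 (mem_degLT.2 fun k hk => ?_)
  rw [coeff_C_mul, coeff_t_pow, if_neg (by omega), mul_zero]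

variable [Nontrivial D]

theorem DiffExt.tensorMap_mul (x y : DiffExt δ.toNC p d ⊗[F] D) :
    tensorMap D δ p d (x * y) = tensorMap D δ p d x * tensorMap D δ p d y := by
  induction x with
  | zero => rw [zero_mul, map_zero, zero_mul]
  | add x₁ x₂ h₁ h₂ => rw [add_mul, map_add, map_add, h₁, h₂, add_mul]
  | tmul x b =>
    induction y with
    | zero => rw [mul_zero, map_zero, mul_zero]
    | add y₁ y₂ h₁ h₂ => rw [mul_add, map_add, map_add, h₁, h₂, mul_add]
    | tmul y b' =>
      have hmem : ∀ (x : DiffExt δ.toNC p d) (b : D), tensorHom D δ (x.rep ⊗ₜ[F] b) ∈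
          degLT (δ.extendNC D) (t (δ.extendNC D) ^ p - t (δ.extendNC D) -
            C (δ.extendNC D) ((1 : D) ⊗ₜ[F] d)).natDeg := fun x b =>
        (DiffExt.mem_degLT_iff p).2
          (tensorHom_mem_degLT D δ ((DiffExt.mem_degLT_iff p).1 x.2) b)
      rw [Algebra.TensorProduct.tmul_mul_tmul, tensorMap_tmul, tensorMap_tmul, tensorMap_tmul,
        PetitAlgebra.mk_mul_mk (hmem x b) (hmem y b'), ← map_mul,
        Algebra.TensorProduct.tmul_mul_tmul]
      obtain ⟨q, hq⟩ := modR_eq _ (monic_pow_sub δ.toNC p hp.out.one_lt d) (x.rep * y.rep)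
      -- The quotient is the image of `q ⊗ b b'`: constants from `D` can be moved to the left, and
      -- the inclusion carries `tᵖ - t - d` to its counterpart over `D_E`.
      refine (PetitAlgebra.mk_eq_mk
        (C (δ.extendNC D) ((b * b') ⊗ₜ[F] (1 : E)) * inclHom D δ q) ?_).symm
      rw [hq, TensorProduct.add_tmul, map_add]
      congr 1
      rw [tensorHom_tmul', map_mul, map_sub, map_sub, map_pow, inclHom_t, inclHom_C, mul_assoc]

/-- Coefficients in `D ⊗ E` are sums of pure tensors, and `(b ⊗ a) tⁱ` is the image of `a tⁱ ⊗ b`.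
Injectivity then follows from equality of dimensions. -/
theorem DiffExt.tensorMap_surjective : Function.Surjective (tensorMap D δ p d) := by
  intro y
  have hy : y.rep = _ := eq_sum ((DiffExt.mem_degLT_iff p).1 y.2)
  rw [← LinearMap.mem_range, ← PetitAlgebra.mk_rep y, hy]
  change PetitAlgebra.mkHom _ (monic_pow_sub (δ.extendNC D) p hp.out.one_lt _) _ ∈ _
  rw [map_sum]
  refine Submodule.sum_mem _ fun i hi => ?_
  generalize coeff y.rep i = w
  induction w with
  | zero => rw [C_zero, zero_mul, map_zero]; exact Submodule.zero_mem _
  | add v w hv hw => rw [C_add, add_mul, map_add]; exact Submodule.add_mem _ hv hw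
  | tmul b a => exact ⟨_, tensorMap_monomial D δ p d a i b (Finset.mem_range.1 hi)⟩

variable [FiniteDimensional F E] [FiniteDimensional F D]

theorem DiffExt.finite_finrank_tensor : Module.Finite F (DiffExt δ.toNC p d) ∧
    Module.finrank F (DiffExt δ.toNC p d ⊗[F] D) =
      p * Module.finrank F E * Module.finrank F D := by
  obtain ⟨h1, h2⟩ := PetitAlgebra.finite_finrank (F := F) _
    (monic_pow_sub δ.toNC p hp.out.one_lt d)
  refine ⟨h1, ?_⟩
  rw [Module.finrank_tensorProduct, h2, natDeg_t_pow_sub p hp.out.one_lt]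

/-- The isomorphism `(E, δ, d) ⊗ D ≃ (D_E, δ, d)`. -/
def DiffExt.tensorEquiv :
    (DiffExt δ.toNC p d ⊗[F] D) ≃ₗ[F] DiffExt (δ.extendNC D) p ((1 : D) ⊗ₜ[F] d) :=
  have h := PetitAlgebra.finite_finrank (F := F) _
    (monic_pow_sub (δ.extendNC D) p hp.out.one_lt ((1 : D) ⊗ₜ[F] d))
  have := h.1
  have := (finite_finrank_tensor D δ p d).1
  have hfr : Module.finrank F (DiffExt δ.toNC p d ⊗[F] D) =
      Module.finrank F (DiffExt (δ.extendNC D) p ((1 : D) ⊗ₜ[F] d)) := by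
    rw [(finite_finrank_tensor D δ p d).2, h.2, natDeg_t_pow_sub p hp.out.one_lt,
      Module.finrank_tensorProduct]
    ring
  LinearEquiv.ofBijective (tensorMap D δ p d)
    ⟨(LinearMap.injective_iff_surjective_of_finrank_eq_finrank hfr).2
      (tensorMap_surjective D δ p d), tensorMap_surjective D δ p d⟩

end TensorIso

/-- Conjugation by `φ` relates two different groups, so powers are compared elementwise. -/
theorem LinearEquiv.orderOf_conj {R V W : Type*} [Semiring R] [AddCommMonoid V] [Module R V]
    [AddCommMonoid W] [Module R W] (φ : V ≃ₗ[R] W) (S : W ≃ₗ[R] W) :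
    orderOf (φ.trans (S.trans φ.symm)) = orderOf S := by
  have hpow : ∀ (n : ℕ) (x : V), φ (((φ.trans (S.trans φ.symm)) ^ n) x) = (S ^ n) (φ x) :=
    fun n x => by
      induction n with
      | zero => rfl
      | succ n ih =>
        rw [pow_succ', pow_succ', LinearEquiv.mul_apply, LinearEquiv.mul_apply, ← ih,
          LinearEquiv.trans_apply, LinearEquiv.trans_apply, LinearEquiv.apply_symm_apply]
  refine orderOf_eq_orderOf_iff.2 fun n => ⟨fun h => ?_, fun h => ?_⟩
  · ext y
    obtain ⟨x, rfl⟩ := φ.surjective y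
    rw [← hpow, h]
    rfl
  · ext x
    refine φ.injective ?_
    rw [hpow, h]
    rfl

end

/-! ### The main theorem. -/

theorem mainTheorem4 {F E D : Type*} [Field F] [Field E] [Algebra F E] [FiniteDimensional F E]
    [DivisionRing D] [Algebra F D] [Algebra.IsCentral F D] [FiniteDimensional F D]
    (p : ℕ) [Fact p.Prime] [CharP F p]
    [IsPurelyInseparable.HasExponent F E] (hexp : IsPurelyInseparable.exponent F E = 1)
    (δ : Derivation F E E)
    (hconst : ∀ a : E, δ a = 0 ↔ a ∈ (algebraMap F E).range)
    (hmin : minpoly F (δ.toLinearMap : Module.End F E) =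
      (Polynomial.X ^ p - Polynomial.X : Polynomial F))
    (hDE : IsDivisionAlgebra (D ⊗[F] E)) (d : E) :
    -- the tensor product has dimension `p² [D : F]`
    Module.finrank F (DiffExt δ.toNC p d ⊗[F] D) = p ^ 2 * Module.finrank F D ∧
    -- it is a division algebra if and only if `d ≠ V_p(z) - z` for all `z`
    (IsDivisionAlgebra (DiffExt δ.toNC p d ⊗[F] D) ↔
      ∀ z : D ⊗[F] E, (1 : D) ⊗ₜ[F] d ≠ DiffPoly.V (δ.extendNC D) p z - z) ∧
    -- equivalently, `d ≠ tᵖ - (t - z)ᵖ - z` for all `z`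
    ((∀ z : D ⊗[F] E, (1 : D) ⊗ₜ[F] d ≠ DiffPoly.V (δ.extendNC D) p z - z) ↔
      ∀ z : D ⊗[F] E, DiffPoly.C (δ.extendNC D) ((1 : D) ⊗ₜ[F] d) ≠
        DiffPoly.t (δ.extendNC D) ^ p -
          (DiffPoly.t (δ.extendNC D) - DiffPoly.C (δ.extendNC D) z) ^ p -
            DiffPoly.C (δ.extendNC D) z) ∧
    -- the canonical isomorphism with `D_E[t;δ]/D_E[t;δ](tᵖ - t - d)`
    ∃ φ : (DiffExt δ.toNC p d ⊗[F] D) ≃ₗ[F] DiffExt (δ.extendNC D) p ((1 : D) ⊗ₜ[F] d),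
      (∀ x y, φ (x * y) = φ x * φ y) ∧
      (∀ (a : E) (i : ℕ) (b : D), i < p →
        φ (PetitAlgebra.mk _ _ (DiffPoly.C δ.toNC a * DiffPoly.t δ.toNC ^ i) ⊗ₜ[F] b) =
          PetitAlgebra.mk _ _
            (DiffPoly.C (δ.extendNC D) (b ⊗ₜ[F] a) * DiffPoly.t (δ.extendNC D) ^ i)) ∧
      -- `G_{id,-1}` is an automorphism which is the identity on `D` and generates a cyclic
      -- subgroup of order `p`
      ∃ G ∈ NAAut F (DiffExt δ.toNC p d ⊗[F] D),
        (∀ x, (φ (G x)).rep = DiffPoly.shift (-1) (φ x).rep) ∧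
        (∀ b : D, G (1 ⊗ₜ[F] b) = 1 ⊗ₜ[F] b) ∧
        Nat.card (Subgroup.zpowers G) = p := by 
  have hfr := δ.finrank_eq_of_minpoly p hconst hmin
  have hnt : Nontrivial (D ⊗[F] E) := hDE.1
  have hdim := (DiffExt.finite_finrank_tensor D δ p d).2
  let φ := DiffExt.tensorEquiv D δ p d
  have hφ : ∀ x y, φ (x * y) = φ x * φ y := DiffExt.tensorMap_mul D δ p d
  have hφ' : ∀ x y, φ.symm (x * y) = φ.symm x * φ.symm y := fun x y => φ.injective (by
    rw [hφ, LinearEquiv.apply_symm_apply, LinearEquiv.apply_symm_apply,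
      LinearEquiv.apply_symm_apply])
  let S := DiffExt.shift (δ.extendNC D) p ((1 : D) ⊗ₜ[F] d)
  refine ⟨?_, ?_, ?_, φ, hφ, fun a i b hi => DiffExt.tensorMap_monomial D δ p d a i b hi,
    φ.trans (S.trans φ.symm), fun x y => ?_, fun x => ?_, fun b => ?_, ?_⟩
  · rw [hdim, hfr, sq]
  · rw [← DiffExt.isDivisionAlgebra_iff hDE.isUnit (δ.extendNC D) p]
    exact ⟨.of_equiv φ hφ, .of_equiv φ.symm hφ'⟩
  · refine forall_congr' fun z => not_congr ?_
    rw [DiffPoly.sub_C_pow, sub_sub_cancel, ← DiffPoly.C_sub, DiffPoly.C_injective.eq_iff]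
  · simp only [LinearEquiv.trans_apply]
    rw [hφ, DiffExt.shift_mul, hφ']
  · simp only [LinearEquiv.trans_apply, LinearEquiv.apply_symm_apply]
    -- `shiftEquiv` unfolds to the very sum defining `DiffPoly.shift (-1)`.
    exact DiffExt.rep_shift _ p _ _
  · have h1 : φ (1 ⊗ₜ[F] b) =
        PetitAlgebra.mk _ _ (DiffPoly.C (δ.extendNC D) (b ⊗ₜ[F] (1 : E))) := by
      -- `1 ⊗ b` is the monomial case `a = 1`, `i = 0`; its image is a constant, which `σ` fixes.
      have h := DiffExt.tensorMap_monomial D δ p d 1 0 b (Fact.out : p.Prime).pos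
      rwa [pow_zero, mul_one, pow_zero, mul_one, DiffPoly.C_one] at h
    have hmem : DiffPoly.C (δ.extendNC D) (b ⊗ₜ[F] (1 : E)) ∈ DiffPoly.degLT (δ.extendNC D)
        (DiffPoly.t (δ.extendNC D) ^ p - DiffPoly.t (δ.extendNC D) -
          DiffPoly.C (δ.extendNC D) ((1 : D) ⊗ₜ[F] d)).natDeg :=
      (DiffExt.mem_degLT_iff p).2 <| DiffPoly.mem_degLT.2 fun k hk => by
        rw [DiffPoly.coeff_C, if_neg (by have := (Fact.out : p.Prime).pos; omega)]
    refine φ.injective ?_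
    simp only [LinearEquiv.trans_apply, LinearEquiv.apply_symm_apply]
    rw [h1]
    refine PetitAlgebra.ext_rep _ _ ?_
    rw [DiffExt.rep_shift, PetitAlgebra.rep_mk_of_mem hmem, DiffPoly.shiftEquiv_C]
  · rw [Nat.card_zpowers, LinearEquiv.orderOf_conj, DiffExt.orderOf_shift]
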